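/- **Setup.** Let $[4]=\{1,2,3,4\}$. A correlation matrix is a real positive definite symmetric $4\times4$ matrix $R=(r_{ij})$ with ones on the diagonal; it is identified with the vector $(r_{12},r_{13},r_{14},r_{23},r_{24},r_{34})\in\mathbb{R}^6$. A couple $ij|C$ consists of a two-element set $\{i,j\}\subset[4]$ and a set $C\subseteq[4]\setminus\{i,j\}$ (written $ij$ if $C=\emptyset$), and a relation $\mathcal{L}$ is a set of couples. Let $R_{iC,jC}$ be the submatrix of $R$ with rows $\{i\}\cup C$ and columns $\{j\}\cup C$, and put $$V_{cor}(\mathcal{L})=\{R \text{ correlation matrix}: \det R_{iC,jC}=0 \text{ for all } ij|C\in\mathcal{L}\},\qquad I_{\mathcal{L}}=\langle \det R_{iC,jC}: ij|C\in\mathcal{L}\rangle\subseteq\mathbb{R}[r_{12},\dots,r_{34}].$$ A *singularity* of $V_{cor}(\mathcal{L})$ is a point of $V_{cor}(\mathcal{L})$ that is a singular point of the complex variety $V_{\mathbb{C}}(I_{\mathcal{L}})\subseteq\mathbb{C}^6$, i.e. it lies on two different irreducible components, or it lies on an irreducible component $W$ and the Jacobian matrix of generators of the vanishing ideal of $W$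 has rank smaller than $\operatorname{codim}W$ at the point. For $R_0\in V_{cor}(\mathcal{L})$, the *tangent cone* $TC_{\mathcal{L}}(R_0)$ is the set of all limits of sequences $\alpha_n(R_n-R_0)$ with $\alpha_n>0$, $R_n\in V_{cor}(\mathcal{L})$ and $R_n\to R_0$. For a polynomial $f\neq 0$, let $f_{R_0,\min}$ be the nonzero homogeneous component of least degree of the polynomial $t\mapsto f(R_0+t)$; let $C_{\mathcal{L}}(R_0)$ be the ideal generated by all $f_{R_0,\min}$ with $0\ne f\in I_{\mathcal{L}}$, and let $AC_{\mathcal{L}}(R_0)\subseteq\mathbb{R}^6$ be the real zero set of $C_{\mathcal{L}}(R_0)$. Consider the following eight relations: $\mathcal{L}_{14}=\{14,\,14|23,\,23|14\}$, $\mathcal{L}_{20}=\{14|2,\,14|3,\,23|14\}$, $\mathcal{L}_{29}=\{23,\,23|14\}$, $\mathcal{L}_{30}=\{14|2,\,23,\,23|14\}$, $\mathcal{L}_{32}=\{12|3,\,12|4\}$, $\mathcal{L}_{36}=\{12|3,\,12|4,\,34|1\}$, $\mathcal{L}_{46}=\{14,\,14|23,\,23\}$, $\mathcal{L}_{51}=\{14|2,\,14|3,\,23\}$.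 **Theorem.** Let $\mathcal{L}$ be one of these eight relations. Then $TC_{\mathcal{L}}(R_0)=AC_{\mathcal{L}}(R_0)$ at every singularity $R_0$ of $V_{cor}(\mathcal{L})$, and $V_{cor}(\mathcal{L})$ is not a smooth (embedded) manifold. Moreover, with $\mathrm{Id}$ the identity matrix, $$C_{\mathcal{L}_{14}}(\mathrm{Id})=C_{\mathcal{L}_{46}}(\mathrm{Id})=\langle r_{14},\,r_{23},\,r_{12}r_{24}+r_{13}r_{34}\rangle,\qquad C_{\mathcal{L}_{20}}(\mathrm{Id})=C_{\mathcal{L}_{51}}(\mathrm{Id})=\langle r_{14},\,r_{23},\,r_{12}r_{24}-r_{13}r_{34}\rangle,$$ $$C_{\mathcal{L}_{30}}(\mathrm{Id})=\langle r_{14},\,r_{23},\,r_{12}r_{13}+r_{24}r_{34}\rangle,\qquad C_{\mathcal{L}_{36}}(\mathrm{Id})=\langle r_{12},\,r_{34},\,r_{13}r_{23}-r_{14}r_{24}\rangle.$$ For every $\rho\in(-1,1)$: if $R_0$ is the correlation matrix with $r_{14}=\rho$ and all other off-diagonal entries zero, then $$C_{\mathcal{L}_{29}}(R_0)=\langle r_{23},\;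 r_{13}(r_{12}-\rho\, r_{24})+r_{34}(r_{24}-\rho\, r_{12})\rangle;$$ if $R_0$ is the correlation matrix with $r_{34}=\rho$ and all other off-diagonal entries zero, then $$C_{\mathcal{L}_{32}}(R_0)=\langle r_{12},\; r_{13}r_{23}-r_{14}r_{24}\rangle.$$ -/

import Mathlib

open scoped ContDiff Topology
open MvPolynomial

/-! The ground set `[m]` is modelled by `Fin m`; in particular the labels `1, 2, 3, 4` of the ground
set `[4]` are the elements `0, 1, 2, 3` of `Fin 4`.  A symmetric matrix `R` with unit diagonal is
represented by its vector of entries `r i j`, `i < j`, and a symmetric matrix with zero diagonal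
(a direction `R - R₀`) likewise. -/

namespace GaussianCI

/-- The index set `{(i, j) : i < j}` of the off-diagonal entries of a symmetric matrix. -/
abbrev Pairs (m : ℕ) : Type := {p : Fin m × Fin m // p.1 < p.2}

/-- The symmetric matrix with ones on the diagonal and off-diagonal entries `r`. -/
def corrMatrix {m : ℕ} {A : Type*} [One A] (r : Pairs m → A) : Matrix (Fin m) (Fin m) A :=
  Matrix.of fun i j =>
    if h : i < j then r ⟨(i, j), h⟩ else if h : j < i then r ⟨(j, i), h⟩ else 1

/-- A conditional independence couple `ij|C`: a two-element set `ij` (listed in increasing order)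
and a conditioning set `C` disjoint from it. -/
structure CICouple (m : ℕ) where
  i : Fin m
  j : Fin m
  C : Finset (Fin m)
  lt : i < j := by decide
  left_notMem : i ∉ C := by decide
  right_notMem : j ∉ C := by decide

/-- The determinant `det (R_{iC, jC})`; rows are indexed by `i` followed by `C`, columns by `j`
followed by `C`, where the element `none` of `Option C` stands for `i` and for `j`, respectively. -/
def ciDet {m : ℕ} {A : Type*} [CommRing A] (R : Matrix (Fin m) (Fin m) A) (c : CICouple m) : A :=
  (Matrix.of fun a b : Option c.C =>
    R (a.elim c.i Subtype.val) (b.elim c.j Subtype.val)).det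

/-- The set `V_cor(L)` of correlation matrices that satisfy all couples in the relation `L`. -/
def Vcor {m : ℕ} (L : Set (CICouple m)) : Set (Pairs m → ℝ) :=
  {r | (corrMatrix r).PosDef ∧ ∀ c ∈ L, ciDet (corrMatrix r) c = 0}

/-- The conditional independence ideal `I_L`, generated by the determinants `det (R_{iC, jC})` of
the generic matrix, `ij|C ∈ L`. -/
noncomputable def ciIdeal {m : ℕ} (L : Set (CICouple m)) : Ideal (MvPolynomial (Pairs m) ℝ) :=
  Ideal.span ((fun c => ciDet (corrMatrix (X : Pairs m → MvPolynomial (Pairs m) ℝ)) c) '' L)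

section Singular

variable {σ : Type*}

/-- Complex algebraic sets in the affine space `σ → ℂ`. -/
def IsAlgebraicSet (V : Set (σ → ℂ)) : Prop :=
  ∃ I : Ideal (MvPolynomial σ ℂ), V = zeroLocus ℂ I

/-- Irreducible complex algebraic sets. -/
def IsIrreducibleVariety (V : Set (σ → ℂ)) : Prop :=
  IsAlgebraicSet V ∧ V.Nonempty ∧
    ∀ A B : Set (σ → ℂ), IsAlgebraicSet A → IsAlgebraicSet B → V = A ∪ B → A = V ∨ B = V

/-- `W` is an irreducible component of `V`. -/
def IsComponent (V W : Set (σ → ℂ)) : Prop :=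
  Maximal (fun W' => IsIrreducibleVariety W' ∧ W' ⊆ V) W

/-- The rank at `x ∈ V` of the Jacobian matrix of the vanishing ideal of `V`: the dimension of the
span of the gradients at `x` of all polynomials that vanish on `V`.  (For `x ∈ V`, this is the span
of the gradients of any generating set.) -/
noncomputable def jacobianRank (V : Set (σ → ℂ)) (x : σ → ℂ) : ℕ :=
  Module.finrank ℂ (Submodule.span ℂ
    ((fun f : MvPolynomial σ ℂ => fun s : σ => eval x (pderiv s f)) ''
      {f | ∀ z ∈ V, eval z f = 0}))

/-- The dimension of `V`: the Krull dimension of its coordinate ring. -/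
noncomputable def varietyDim (V : Set (σ → ℂ)) : WithBot ℕ∞ :=
  ringKrullDim (MvPolynomial σ ℂ ⧸ vanishingIdeal ℂ V)

/-- `x` is a singular point of the algebraic set `V`: either `x` lies on an irreducible component at
whose point `x` the Jacobian rank is smaller than the codimension of that component, or `x` lies on
two different irreducible components. -/
def IsSingularPoint [Fintype σ] (V : Set (σ → ℂ)) (x : σ → ℂ) : Prop :=
  (∃ W, IsComponent V W ∧ x ∈ W ∧ (jacobianRank W x : WithBot ℕ∞) + varietyDim W < Fintype.card σ) ∨
    ∃ W₁ W₂, IsComponent V W₁ ∧ IsComponent V W₂ ∧ W₁ ≠ W₂ ∧ x ∈ W₁ ∧ x ∈ W₂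

end Singular

/-- The complex variety `V_ℂ(I_L)`. -/
def complexVariety {m : ℕ} (L : Set (CICouple m)) : Set (Pairs m → ℂ) :=
  {z | ∀ f ∈ ciIdeal L, aeval z f = 0}

/-- The singularities of `V_cor(L)`: the points of `V_cor(L)` that are singular points of the
complex variety `V_ℂ(I_L)`. -/
def singularities {m : ℕ} (L : Set (CICouple m)) : Set (Pairs m → ℝ) :=
  {r | r ∈ Vcor L ∧ IsSingularPoint (complexVariety L) (fun p => (r p : ℂ))}

/-- The tangent cone of a set `S` at a point `x`: all limits of sequences `α n • (y n - x)` with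
`α n > 0`, `y n ∈ S` and `y n → x`. -/
def tangentCone {E : Type*} [AddCommGroup E] [Module ℝ E] [TopologicalSpace E]
    (S : Set E) (x : E) : Set E :=
  {t | ∃ (α : ℕ → ℝ) (y : ℕ → E), (∀ n, 0 < α n) ∧ (∀ n, y n ∈ S) ∧
    Filter.Tendsto y Filter.atTop (𝓝 x) ∧
    Filter.Tendsto (fun n => α n • (y n - x)) Filter.atTop (𝓝 t)}

/-- The nonzero homogeneous component of least degree of a polynomial (and `0` for `0`). -/
noncomputable def minForm {σ : Type*} (f : MvPolynomial σ ℝ) : MvPolynomial σ ℝ :=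
  homogeneousComponent (sInf {d : ℕ | homogeneousComponent d f ≠ 0}) f

/-- The polynomial `f_{R₀, min}`: expand `f` in the variables `t = R - R₀` and take the homogeneous
part of least degree. -/
noncomputable def minFormAt {σ : Type*} (x : σ → ℝ) (f : MvPolynomial σ ℝ) : MvPolynomial σ ℝ :=
  minForm (aeval (fun s => C (x s) + X s : σ → MvPolynomial σ ℝ) f)

/-- The ideal `C_L(R₀)` generated by the polynomials `f_{R₀, min}`, `f ∈ I_L`. -/
noncomputable def coneIdeal {m : ℕ} (L : Set (CICouple m)) (x : Pairs m → ℝ) :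
    Ideal (MvPolynomial (Pairs m) ℝ) :=
  Ideal.span (minFormAt x '' (ciIdeal L : Set (MvPolynomial (Pairs m) ℝ)))

/-- The algebraically defined cone `AC_L(R₀)`: the real variety of `C_L(R₀)`. -/
def algCone {m : ℕ} (L : Set (CICouple m)) (x : Pairs m → ℝ) : Set (Pairs m → ℝ) :=
  {t | ∀ f ∈ coneIdeal L x, eval t f = 0}

/-- `S` is a smooth (embedded) manifold: around each of its points, a smooth change of coordinates
of the ambient space turns `S` into a linear subspace (whose dimension may depend on the point). -/
def IsSmoothManifold {E : Type*} [NormedAddCommGroup E] [NormedSpace ℝ E] (S : Set E) : Prop :=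
  ∀ x ∈ S, ∃ (φ : OpenPartialHomeomorph E E) (W : Submodule ℝ E), x ∈ φ.source ∧
    ContDiffOn ℝ ∞ φ φ.source ∧ ContDiffOn ℝ ∞ φ.symm φ.target ∧
    ∀ y ∈ φ.source, y ∈ S ↔ φ y ∈ W

/-! ### The eight relations on four variables -/

abbrev e12 : Pairs 4 := ⟨(0, 1), by decide⟩
abbrev e13 : Pairs 4 := ⟨(0, 2), by decide⟩
abbrev e14 : Pairs 4 := ⟨(0, 3), by decide⟩
abbrev e23 : Pairs 4 := ⟨(1, 2), by decide⟩
abbrev e24 : Pairs 4 := ⟨(1, 3), by decide⟩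
abbrev e34 : Pairs 4 := ⟨(2, 3), by decide⟩

/-- `{14, 14|23, 23|14}` -/
def L14 : Set (CICouple 4) :=
  {{ i := 0, j := 3, C := ∅ }, { i := 0, j := 3, C := {1, 2} }, { i := 1, j := 2, C := {0, 3} }}

/-- `{14|2, 14|3, 23|14}` -/
def L20 : Set (CICouple 4) :=
  {{ i := 0, j := 3, C := {1} }, { i := 0, j := 3, C := {2} }, { i := 1, j := 2, C := {0, 3} }}

/-- `{23, 23|14}` -/
def L29 : Set (CICouple 4) :=
  {{ i := 1, j := 2, C := ∅ }, { i := 1, j := 2, C := {0, 3} }}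

/-- `{14|2, 23, 23|14}` -/
def L30 : Set (CICouple 4) :=
  {{ i := 0, j := 3, C := {1} }, { i := 1, j := 2, C := ∅ }, { i := 1, j := 2, C := {0, 3} }}

/-- `{12|3, 12|4}` -/
def L32 : Set (CICouple 4) :=
  {{ i := 0, j := 1, C := {2} }, { i := 0, j := 1, C := {3} }}

/-- `{12|3, 12|4, 34|1}` -/
def L36 : Set (CICouple 4) :=
  {{ i := 0, j := 1, C := {2} }, { i := 0, j := 1, C := {3} }, { i := 2, j := 3, C := {0} }}

/-- `{14, 14|23, 23}` -/
def L46 : Set (CICouple 4) :=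
  {{ i := 0, j := 3, C := ∅ }, { i := 0, j := 3, C := {1, 2} }, { i := 1, j := 2, C := ∅ }}

/-- `{14|2, 14|3, 23}` -/
def L51 : Set (CICouple 4) :=
  {{ i := 0, j := 3, C := {1} }, { i := 0, j := 3, C := {2} }, { i := 1, j := 2, C := ∅ }}

end GaussianCI

/-! The equality TC = AC is proved at every point `x` of V_cor(L). The inclusion TC ⊆ AC is general:
if `f` vanishes on V_cor(L), then multiplying f(y_n) = 0 by a suitable power of the scaling factor
and passing to the limit leaves only the initial form of `f` at `x` (`eval_minFormAt_eq_zero`).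

For AC ⊆ TC there are two kinds of points. If the gradients of the defining determinants are
linearly independent at `x`, every vector of AC is killed by all of them, because the linear parts
of the determinants lie in the cone ideal; the implicit function theorem then provides a curve in
V_cor(L) with that velocity (`algCone_subset_tangentCone_of_independent`). For each relation,
independence can fail only where four particular entries vanish, which leaves the identity or, for
L29 and L32, a line of matrices with one free entry. There the cone ideal is computed, and each of
its real zeros is the velocity of an explicit curve.

The cone ideal is generated by one or two variables and a quadratic form `q`. That these belong to
it is seen from explicit elements of I_L. For the converse (`minForm_mem`), the elements with linear
initial form are solved for their variables; after this substitution all generators become multiples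
of a single polynomial `g` with initial form `q`, up to terms of arbitrarily high order. Since the
initial form of a product over a domain is the product of the initial forms, every initial form of
I_L is a multiple of `q` modulo the eliminated variables.

Non-smoothness follows because the tangent cone of an embedded manifold is closed under addition,
whereas the quadric `q` = 0 contains two coordinate directions but not their sum. -/

namespace GaussianCI

/-! ### Orders and initial forms of polynomials -/

section InitialForm

variable {σ R : Type*} [CommRing R]

/-- Powers of the ideal of variables encode the order of vanishing at the origin, so that order
estimates for sums and products become ideal arithmetic. -/
lemma mem_pow_idealOfVars_iff_homogeneousComponent {n : ℕ} {p : MvPolynomial σ R} :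
    p ∈ idealOfVars σ R ^ n ↔ ∀ j < n, homogeneousComponent j p = 0 := by
  rw [mem_pow_idealOfVars_iff']
  constructor
  · intro h j hj
    ext d
    rw [coeff_homogeneousComponent]
    split_ifs with hd
    · simpa using h d (hd ▸ hj)
    · simp
  · intro h d hd
    simpa [coeff_homogeneousComponent] using congrArg (coeff d) (h _ hd)

lemma sub_homogeneousComponent_mem {n : ℕ} {p : MvPolynomial σ R}
    (hp : p ∈ idealOfVars σ R ^ n) : p - homogeneousComponent n p ∈ idealOfVars σ R ^ (n + 1) := by
  rw [mem_pow_idealOfVars_iff'] at hp ⊢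
  intro d hd
  rw [coeff_sub, coeff_homogeneousComponent]
  split_ifs with h
  · simp
  · rw [hp d (by omega), sub_zero]

lemma _root_.MvPolynomial.IsHomogeneous.mem_pow_idealOfVars {n : ℕ} {p : MvPolynomial σ R}
    (hp : p.IsHomogeneous n) : p ∈ idealOfVars σ R ^ n := by
  rw [mem_pow_idealOfVars_iff']
  exact fun d hd => hp.coeff_eq_zero hd.ne

/-- This is how initial forms are recognised throughout: a congruence modulo terms of order n + 1
determines the component of degree n. -/
lemma homogeneousComponent_eq_of_sub_mem {n : ℕ} {p q : MvPolynomial σ R} (hq : q.IsHomogeneous n)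
    (h : p - q ∈ idealOfVars σ R ^ (n + 1)) : homogeneousComponent n p = q := by
  have := mem_pow_idealOfVars_iff_homogeneousComponent.1 h n n.lt_succ_self
  rwa [map_sub, homogeneousComponent_eq_self hq, sub_eq_zero] at this

lemma mem_pow_of_sub_mem {n : ℕ} {p q : MvPolynomial σ R} (hq : q.IsHomogeneous n)
    (h : p - q ∈ idealOfVars σ R ^ (n + 1)) : p ∈ idealOfVars σ R ^ n := by
  simpa using add_mem (Ideal.pow_le_pow_right n.le_succ h) hq.mem_pow_idealOfVars

lemma exists_mem_pow_homogeneousComponent_ne_zero {p : MvPolynomial σ R} (hp : p ≠ 0) :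
    ∃ n, p ∈ idealOfVars σ R ^ n ∧ homogeneousComponent n p ≠ 0 := by
  classical
  have h : ∃ n, homogeneousComponent n p ≠ 0 := by
    by_contra! h
    apply hp
    rw [← sum_homogeneousComponent p]
    exact Finset.sum_eq_zero fun i _ => h i
  refine ⟨Nat.find h, ?_, Nat.find_spec h⟩
  rw [mem_pow_idealOfVars_iff_homogeneousComponent]
  intro j hj
  simpa using Nat.find_min h hj

lemma X_mem_pow_one (s : σ) : (X s : MvPolynomial σ R) ∈ idealOfVars σ R :=
  Ideal.subset_span ⟨s, rfl⟩

lemma X_mul_X_mem (s t : σ) : (X s * X t : MvPolynomial σ R) ∈ idealOfVars σ R ^ 2 := by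
  rw [pow_two]
  exact Ideal.mul_mem_mul (X_mem_pow_one s) (X_mem_pow_one t)

lemma X_mul_X_mul_X_mem (s t u : σ) :
    (X s * X t * X u : MvPolynomial σ R) ∈ idealOfVars σ R ^ 3 := by
  rw [pow_succ]
  exact Ideal.mul_mem_mul (X_mul_X_mem s t) (X_mem_pow_one u)

/-- A substitution that agrees with a linear one up to terms of order two changes a polynomial of
order `n` only in orders above `n`. -/
lemma aeval_sub_aeval_mem {θ θ₀ : σ → MvPolynomial σ R}
    (h : ∀ s, θ s - θ₀ s ∈ idealOfVars σ R ^ 2) (h₀ : ∀ s, θ₀ s ∈ idealOfVars σ R) (n : ℕ) :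
    ∀ p ∈ idealOfVars σ R ^ n, aeval θ p ∈ idealOfVars σ R ^ n ∧
      aeval θ p - aeval θ₀ p ∈ idealOfVars σ R ^ (n + 1) := by
  have hle : idealOfVars σ R ^ 2 ≤ idealOfVars σ R := Ideal.pow_le_self two_ne_zero
  have hθ (s) : θ s ∈ idealOfVars σ R := by simpa using add_mem (hle (h s)) (h₀ s)
  -- A crude congruence valid for every polynomial, with no condition on its order; it handles the
  -- arbitrary coefficients of linear combinations of variables below.
  have base (p : MvPolynomial σ R) : aeval θ p - aeval θ₀ p ∈ idealOfVars σ R := by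
    induction p using MvPolynomial.induction_on with
    | C a => simp
    | add p q hp hq =>
      rw [map_add, map_add, add_sub_add_comm]
      exact add_mem hp hq
    | mul_X p s hp =>
      rw [map_mul, map_mul, aeval_X, aeval_X]
      exact sub_mem (Ideal.mul_mem_left _ _ (hθ s)) (Ideal.mul_mem_left _ _ (h₀ s))
  have one (a : MvPolynomial σ R) (ha : a ∈ idealOfVars σ R) :
      aeval θ a - aeval θ₀ a ∈ idealOfVars σ R ^ 2 ∧ aeval θ₀ a ∈ idealOfVars σ R := by
    refine Submodule.span_induction ?_ (by simp) ?_ ?_ ha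
    · rintro _ ⟨s, rfl⟩
      simpa using ⟨h s, h₀ s⟩
    · intro x y _ _ hx hy
      rw [map_add, map_add, add_sub_add_comm]
      exact ⟨add_mem hx.1 hy.1, add_mem hx.2 hy.2⟩
    · intro u x _ hx
      have e : aeval θ (u • x) - aeval θ₀ (u • x) =
          aeval θ u * (aeval θ x - aeval θ₀ x) + (aeval θ u - aeval θ₀ u) * aeval θ₀ x := by
        simp only [smul_eq_mul, map_mul]
        ring
      rw [e, smul_eq_mul, map_mul]
      refine ⟨add_mem (Ideal.mul_mem_left _ _ hx.1) ?_, Ideal.mul_mem_left _ _ hx.2⟩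
      rw [pow_two]
      exact Ideal.mul_mem_mul (base u) hx.2
  induction n with
  | zero => exact fun p _ => ⟨by simp, by simpa using base p⟩
  | succ n ih =>
    intro p hp
    rw [pow_succ'] at hp
    refine Submodule.mul_induction_on hp ?_ ?_
    · intro a ha b hb
      obtain ⟨h1, h2⟩ := one a ha
      obtain ⟨h3, h4⟩ := ih b hb
      have e : aeval θ (a * b) - aeval θ₀ (a * b) =
          (aeval θ a - aeval θ₀ a) * aeval θ b + aeval θ₀ a * (aeval θ b - aeval θ₀ b) := by
        simp only [map_mul]
        ring
      constructor
      · rw [map_mul, pow_succ']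
        refine Ideal.mul_mem_mul ?_ h3
        simpa using add_mem (hle h1) h2
      · rw [e]
        refine add_mem ?_ ?_
        · rw [show n + 1 + 1 = 2 + n by ring, pow_add]
          exact Ideal.mul_mem_mul h1 h3
        · rw [pow_succ']
          exact Ideal.mul_mem_mul h2 h4
    · intro x y hx hy
      rw [map_add, map_add, add_sub_add_comm]
      exact ⟨add_mem hx.1 hy.1, add_mem hx.2 hy.2⟩

/-- If `g` has initial form `q` of degree `m`, the component of least degree of a multiple of `g`
is a multiple of `q`. -/
lemma homogeneousComponent_mul_mem_span [IsDomain R] {g q h : MvPolynomial σ R} {m n : ℕ}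
    (hq : q.IsHomogeneous m) (hq0 : q ≠ 0) (hg : g - q ∈ idealOfVars σ R ^ (m + 1))
    (hn : h * g ∈ idealOfVars σ R ^ n) : homogeneousComponent n (h * g) ∈ Ideal.span {q} := by
  by_cases h0 : h = 0
  · simp [h0]
  obtain ⟨j, hj, hj0⟩ := exists_mem_pow_homogeneousComponent_ne_zero h0
  have hom : (homogeneousComponent j h * q).IsHomogeneous (j + m) :=
    (homogeneousComponent_isHomogeneous j h).mul hq
  have key : h * g - homogeneousComponent j h * q ∈ idealOfVars σ R ^ (j + m + 1) := by
    have e : h * g - homogeneousComponent j h * q =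
        h * (g - q) + (h - homogeneousComponent j h) * q := by ring
    rw [e]
    refine add_mem ?_ ?_
    · rw [add_assoc, pow_add]
      exact Ideal.mul_mem_mul hj hg
    · rw [show j + m + 1 = (j + 1) + m by ring, pow_add]
      exact Ideal.mul_mem_mul (sub_homogeneousComponent_mem hj) hq.mem_pow_idealOfVars
  have comp := homogeneousComponent_eq_of_sub_mem hom key
  -- The product has exact order j + m, since initial forms multiply to something nonzero. Hence n
  -- cannot exceed it, at n = j + m the component is the product of initial forms, and below it the
  -- component is zero.
  rcases lt_trichotomy (j + m) n with hlt | rfl | hgt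
  · rw [mem_pow_idealOfVars_iff_homogeneousComponent.1 hn _ hlt] at comp
    exact absurd comp.symm (mul_ne_zero hj0 hq0)
  · rw [comp]
    exact Ideal.mul_mem_left _ _ (Ideal.mem_span_singleton_self q)
  · have := mem_pow_idealOfVars_iff_homogeneousComponent.1 (mem_pow_of_sub_mem hom key) _ hgt
    rw [this]
    exact zero_mem _

end InitialForm

lemma map_ciDet {m : ℕ} {A B : Type*} [CommRing A] [CommRing B] (φ : A →+* B) (r : Pairs m → A)
    (c : CICouple m) : φ (ciDet (corrMatrix r) c) = ciDet (corrMatrix fun s => φ (r s)) c := by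
  unfold ciDet
  rw [RingHom.map_det]
  congr 1
  ext a b
  simp only [RingHom.mapMatrix_apply, Matrix.map_apply, Matrix.of_apply, corrMatrix]
  split_ifs <;> simp

/-! ### Initial forms of ideal elements and bounds for the cone ideal -/

section MinForm

variable {σ : Type*}

lemma minForm_eq {p : MvPolynomial σ ℝ} {n : ℕ} (hp : p ∈ idealOfVars σ ℝ ^ n)
    (h0 : homogeneousComponent n p ≠ 0) : minForm p = homogeneousComponent n p := by
  have : sInf {d : ℕ | homogeneousComponent d p ≠ 0} = n := by
    refine le_antisymm (Nat.sInf_le h0) (le_csInf ⟨n, h0⟩ fun d hd => ?_)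
    by_contra! hlt
    exact hd (mem_pow_idealOfVars_iff_homogeneousComponent.1 hp d hlt)
  rw [minForm, this]

lemma minForm_zero : minForm (0 : MvPolynomial σ ℝ) = 0 := by simp [minForm]

/-- Initial forms of the elements of an ideal whose generators become, under a substitution that
kills the variables in `Z` to first order, multiples of a polynomial with initial form `q`. -/
lemma minForm_mem {Z : Set σ} {J : Ideal (MvPolynomial σ ℝ)} {q : MvPolynomial σ ℝ} {m : ℕ}
    (hZ : ∀ s ∈ Z, X s ∈ J) (hqJ : q ∈ J) (hq : q.IsHomogeneous m) (hq0 : q ≠ 0)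
    {G : Set (MvPolynomial σ ℝ)}
    (hG : ∀ k, ∃ (θ : σ → MvPolynomial σ ℝ) (g : MvPolynomial σ ℝ),
      (∀ s ∈ Z, θ s ∈ idealOfVars σ ℝ ^ 2) ∧ (∀ s ∉ Z, θ s = X s) ∧
      g - q ∈ idealOfVars σ ℝ ^ (m + 1) ∧
      ∀ p ∈ G, ∃ u, aeval θ p - u * g ∈ idealOfVars σ ℝ ^ (k + 1))
    {f : MvPolynomial σ ℝ} (hf : f ∈ Ideal.span G) : minForm f ∈ J := by
  classical
  by_cases hf0 : f = 0
  · simp [hf0, minForm_zero]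
  obtain ⟨k, hk, hk0⟩ := exists_mem_pow_homogeneousComponent_ne_zero hf0
  rw [minForm_eq hk hk0]
  -- The substitution is chosen after the order k of f is known, so it only has to be correct modulo
  -- order k + 1. This admits truncated power series as substitutions.
  obtain ⟨θ, g, hθZ, hθ, hgq, hgen⟩ := hG k
  set fk := homogeneousComponent k f with hfk
  let θ₀ : σ → MvPolynomial σ ℝ := fun s => if s ∈ Z then 0 else X s
  have hθ₀ (s) : θ₀ s ∈ idealOfVars σ ℝ := by
    by_cases hs : s ∈ Z
    · simp [θ₀, hs]
    · simpa [θ₀, hs] using X_mem_pow_one s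
  have hsub (s) : θ s - θ₀ s ∈ idealOfVars σ ℝ ^ 2 := by
    by_cases hs : s ∈ Z
    · simpa [θ₀, hs] using hθZ s hs
    · simp [θ₀, hs, hθ s hs]
  have hfg : ∃ u, aeval θ f - u * g ∈ idealOfVars σ ℝ ^ (k + 1) := by
    refine Submodule.span_induction (fun p hp => hgen p hp) ⟨0, by simp⟩ ?_ ?_ hf
    · rintro x y _ _ ⟨u, hu⟩ ⟨v, hv⟩
      refine ⟨u + v, ?_⟩
      have := add_mem hu hv
      rwa [show aeval θ x - u * g + (aeval θ y - v * g) =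
        aeval θ (x + y) - (u + v) * g by rw [map_add]; ring] at this
    · rintro a x _ ⟨u, hu⟩
      refine ⟨aeval θ a * u, ?_⟩
      have := Ideal.mul_mem_left _ (aeval θ a) hu
      rwa [show aeval θ a * (aeval θ x - u * g) = aeval θ (a • x) - aeval θ a * u * g by
        rw [smul_eq_mul, map_mul]; ring] at this
  obtain ⟨u, hu⟩ := hfg
  have hfkhom : fk.IsHomogeneous k := homogeneousComponent_isHomogeneous k f
  have h0hom : (aeval θ₀ fk).IsHomogeneous k := by
    have := hfkhom.aeval (n := 1) θ₀ fun s => by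
      by_cases hs : s ∈ Z
      · simpa [θ₀, hs] using isHomogeneous_zero _ _ _
      · simpa [θ₀, hs] using isHomogeneous_X _ _
    simpa using this
  -- Modulo order k + 1, both u * g and the linear substitution `θ₀` applied to the initial form
  -- agree with `aeval θ f`.
  have hd : u * g - aeval θ₀ fk ∈ idealOfVars σ ℝ ^ (k + 1) := by
    have h1 := (aeval_sub_aeval_mem hsub hθ₀ k fk hfkhom.mem_pow_idealOfVars).2
    have h2 := (aeval_sub_aeval_mem hsub hθ₀ (k + 1) _ (sub_homogeneousComponent_mem hk)).1
    have := sub_mem (add_mem h1 h2) hu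
    rwa [show aeval θ fk - aeval θ₀ fk + aeval θ (f - fk) - (aeval θ f - u * g) =
      u * g - aeval θ₀ fk by rw [map_sub]; ring] at this
  have h0J : aeval θ₀ fk ∈ J := by
    rw [← homogeneousComponent_eq_of_sub_mem h0hom hd]
    exact (Ideal.span_singleton_le_iff_mem J).2 hqJ
      (homogeneousComponent_mul_mem_span hq hq0 hgq (mem_pow_of_sub_mem h0hom hd))
  -- Modulo J the substitution `θ₀` changes nothing, because it only kills variables that lie in J;
  -- so membership passes from `aeval θ₀ fk` back to `fk`.
  have hmk : (Ideal.Quotient.mkₐ ℝ J).comp (aeval θ₀) = Ideal.Quotient.mkₐ ℝ J := by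
    ext s
    by_cases hs : s ∈ Z
    · simpa [θ₀, hs] using (Ideal.Quotient.eq_zero_iff_mem.2 (hZ s hs)).symm
    · simp [θ₀, hs]
  have hmk' := DFunLike.congr_fun hmk fk
  rw [← Ideal.Quotient.eq_zero_iff_mem] at h0J ⊢
  rw [← Ideal.Quotient.mkₐ_eq_mk ℝ] at h0J ⊢
  rw [← hmk', AlgHom.comp_apply, h0J]

/-- Translation of polynomials to the point `x`. -/
noncomputable def translate (x : σ → ℝ) : MvPolynomial σ ℝ →ₐ[ℝ] MvPolynomial σ ℝ :=
  aeval (fun s => C (x s) + X s : σ → MvPolynomial σ ℝ)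

lemma translate_X (x : σ → ℝ) (s : σ) : translate x (X s) = C (x s) + X s := by simp [translate]

lemma minFormAt_eq (x : σ → ℝ) (f : MvPolynomial σ ℝ) : minFormAt x f = minForm (translate x f) :=
  rfl

lemma eval_translate (x t : σ → ℝ) (f : MvPolynomial σ ℝ) :
    eval t (translate x f) = eval (x + t) f := by
  induction f using MvPolynomial.induction_on with
  | C a => simp [translate]
  | add p q hp hq => simp [hp, hq]
  | mul_X p s hp => simp [hp, translate_X]

variable {m : ℕ} {L : Set (CICouple m)}

/-- The lower bound for the cone ideal. The form q may be zero, in which case it need not be the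
initial form of f; linear parts can thus be used without checking that they are nonzero. -/
lemma mem_coneIdeal {x : Pairs m → ℝ} {f q : MvPolynomial (Pairs m) ℝ} {n : ℕ}
    (hf : f ∈ ciIdeal L) (hq : q.IsHomogeneous n)
    (h : translate x f - q ∈ idealOfVars (Pairs m) ℝ ^ (n + 1)) : q ∈ coneIdeal L x := by
  by_cases hq0 : q = 0
  · simp [hq0]
  have hc := homogeneousComponent_eq_of_sub_mem hq h
  have : minFormAt x f = q := by
    rw [minFormAt_eq, minForm_eq (mem_pow_of_sub_mem hq h) (hc ▸ hq0), hc]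
  exact this ▸ Ideal.subset_span ⟨f, hf, rfl⟩

/-- Upper bound for the cone ideal, by elimination of the variables in `Z`. -/
lemma coneIdeal_le {x : Pairs m → ℝ} {Z : Set (Pairs m)} {J : Ideal (MvPolynomial (Pairs m) ℝ)}
    {q : MvPolynomial (Pairs m) ℝ} {n : ℕ}
    (hZ : ∀ s ∈ Z, X s ∈ J) (hqJ : q ∈ J) (hq : q.IsHomogeneous n) (hq0 : q ≠ 0)
    (hL : ∀ k, ∃ (θ : Pairs m → MvPolynomial (Pairs m) ℝ) (g : MvPolynomial (Pairs m) ℝ),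
      (∀ s ∈ Z, θ s ∈ idealOfVars (Pairs m) ℝ ^ 2) ∧ (∀ s ∉ Z, θ s = X s) ∧
      g - q ∈ idealOfVars (Pairs m) ℝ ^ (n + 1) ∧
      ∀ c ∈ L, ∃ u, ciDet (corrMatrix fun s => C (x s) + θ s) c - u * g ∈
        idealOfVars (Pairs m) ℝ ^ (k + 1)) :
    coneIdeal L x ≤ J := by
  rw [coneIdeal, Ideal.span_le]
  rintro _ ⟨f, hf, rfl⟩
  rw [minFormAt_eq]
  refine minForm_mem (G := translate x '' ((fun c => ciDet (corrMatrix
    (X : Pairs m → MvPolynomial (Pairs m) ℝ)) c) '' L)) hZ hqJ hq hq0 (fun k => ?_) ?_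
  · obtain ⟨θ, g, h1, h2, h3, h4⟩ := hL k
    refine ⟨θ, g, h1, h2, h3, ?_⟩
    rintro _ ⟨_, ⟨c, hc, rfl⟩, rfl⟩
    obtain ⟨u, hu⟩ := h4 c hc
    refine ⟨u, ?_⟩
    have e1 := map_ciDet (translate x).toRingHom X c
    have e2 := map_ciDet (aeval θ : MvPolynomial (Pairs m) ℝ →ₐ[ℝ] MvPolynomial (Pairs m) ℝ).toRingHom
      (fun s => translate x (X s)) c
    simp only [AlgHom.toRingHom_eq_coe, RingHom.coe_coe, translate_X,
      map_add, aeval_X, aeval_C, MvPolynomial.algebraMap_eq] at e1 e2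
    rw [e1, e2]
    exact hu
  · have := Ideal.mem_map_of_mem (translate x) hf
    rwa [ciIdeal, Ideal.map_span] at this

end MinForm

/-! ### Tangent cones -/

section TangentCone

open Filter

variable {E : Type*} [NormedAddCommGroup E] [NormedSpace ℝ E] {S : Set E} {x : E}

/-- Sample the curve at times u_n decreasing to 0 and rescale by 1/u_n: the rescaled secants are
difference quotients. -/
lemma mem_tangentCone_of_curve {t : E} {y : ℝ → E} (hy : HasDerivAt y t 0) (hx : y 0 = x)
    (hS : ∀ᶠ τ in 𝓝[>] 0, y τ ∈ S) : t ∈ tangentCone S x := by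
  obtain ⟨δ, hδ, hδS⟩ := mem_nhdsGT_iff_exists_Ioo_subset.1 hS
  have hδ' : 0 < δ := hδ
  let u : ℕ → ℝ := fun n => (δ / 2) * (1 / ((n : ℝ) + 1))
  have hu0 : Tendsto u atTop (𝓝 0) := by
    simpa [u] using tendsto_one_div_add_atTop_nhds_zero_nat.const_mul (δ / 2)
  have hupos (n) : 0 < u n := by positivity
  have hult (n) : u n < δ := by
    have h1 : 1 / ((n : ℝ) + 1) ≤ 1 := by
      rw [div_le_one (by positivity)]
      linarith [(Nat.cast_nonneg n : (0 : ℝ) ≤ n)]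
    have := mul_le_mul_of_nonneg_left h1 (half_pos hδ').le
    have h2 : u n ≤ δ / 2 := by simpa [u] using this
    linarith
  have hu : Tendsto u atTop (𝓝[>] 0) :=
    tendsto_nhdsWithin_iff.2 ⟨hu0, Eventually.of_forall hupos⟩
  refine ⟨fun n => (u n)⁻¹, fun n => y (u n), fun n => inv_pos.2 (hupos n),
    fun n => hδS ⟨hupos n, hult n⟩, ?_, ?_⟩
  · rw [← hx]
    exact hy.continuousAt.tendsto.comp hu0
  · have := hy.tendsto_slope_zero_right.comp hu
    simpa [Function.comp_def, hx] using this

/-- The tangent cones of smooth embedded manifolds are closed under addition. -/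
lemma IsSmoothManifold.add_mem_tangentCone [FiniteDimensional ℝ E] (h : IsSmoothManifold S)
    (hx : x ∈ S) {t u : E} (ht : t ∈ tangentCone S x) (hu : u ∈ tangentCone S x) :
    t + u ∈ tangentCone S x := by
  obtain ⟨φ, W, hxφ, hφ, hφs, hW⟩ := h x hx
  have d1 : HasFDerivAt φ (fderiv ℝ φ x) x :=
    ((hφ.contDiffAt (φ.open_source.mem_nhds hxφ)).differentiableAt (by simp)).hasFDerivAt
  have hxt : φ x ∈ φ.target := φ.map_source hxφ
  have d2 : HasFDerivAt φ.symm (fderiv ℝ φ.symm (φ x)) (φ x) :=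
    ((hφs.contDiffAt (φ.open_target.mem_nhds hxt)).differentiableAt (by simp)).hasFDerivAt
  set A := fderiv ℝ φ x
  set B := fderiv ℝ φ.symm (φ x)
  have hBA (v : E) : B (A v) = v := by
    have h1 : HasFDerivAt (φ.symm ∘ φ) (B.comp A) x := d2.comp x d1
    have h2 : HasFDerivAt (φ.symm ∘ φ) (ContinuousLinearMap.id ℝ E) x := by
      refine (hasFDerivAt_id x).congr_of_eventuallyEq ?_
      filter_upwards [φ.open_source.mem_nhds hxφ] with z hz
      simpa using φ.left_inv hz
    exact DFunLike.congr_fun (h1.unique h2) v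
  have hWx : φ x ∈ W := (hW x hxφ).1 hx
  -- In the chart, rescaled secants lie in the subspace W, and so do their limits because W is
  -- closed.
  have sub : ∀ v ∈ tangentCone S x, A v ∈ W := by
    rintro v ⟨α, y, -, hy, hyx, hv⟩
    have hd : Tendsto (fun n => y n - x) atTop (𝓝 0) := by
      simpa using hyx.sub_const x
    have hlim := (hasFDerivWithinAt_univ.2 d1).lim hd (Eventually.of_forall fun _ => trivial) hv
    refine W.closed_of_finiteDimensional.mem_of_tendsto hlim ?_
    filter_upwards [hyx.eventually (φ.open_source.mem_nhds hxφ)] with n hn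
    rw [add_sub_cancel]
    exact W.smul_mem _ (W.sub_mem ((hW _ hn).1 (hy n)) hWx)
  have hsum : A (t + u) ∈ W := by
    rw [map_add]
    exact W.add_mem (sub t ht) (sub u hu)
  set w := A (t + u)
  -- Conversely, the line through `φ x` in direction w stays in W; pulled back by the chart it is a
  -- curve in S with velocity B w = t + u.
  have hl : HasDerivAt (fun τ : ℝ => φ x + τ • w) w 0 := by
    simpa using ((hasDerivAt_id (0 : ℝ)).smul_const w).const_add (φ x)
  have hl0 : Tendsto (fun τ : ℝ => φ x + τ • w) (𝓝 0) (𝓝 (φ x)) := by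
    simpa using hl.continuousAt.tendsto
  have hc : HasDerivAt (fun τ : ℝ => φ.symm (φ x + τ • w)) (B w) 0 :=
    HasFDerivAt.comp_hasDerivAt (f := fun τ : ℝ => φ x + τ • w) 0 (by simpa using d2) hl
  rw [hBA] at hc
  refine mem_tangentCone_of_curve hc (by simpa using φ.left_inv hxφ) ?_
  filter_upwards [nhdsWithin_le_nhds (hl0 (φ.open_target.mem_nhds hxt))] with τ hτ
  rw [hW _ (φ.map_target hτ), φ.right_inv hτ]
  exact W.add_mem hWx (W.smul_mem _ hsum)

end TangentCone

/-! ### Polynomial functions near a point: differentials, Taylor expansion, limits of secants -/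

section Polynomials

open Filter

variable {σ : Type*} [Fintype σ]

/-- The differential of a polynomial function, as a linear functional. -/
noncomputable def polyDeriv (p : MvPolynomial σ ℝ) (x : σ → ℝ) : (σ → ℝ) →L[ℝ] ℝ :=
  ∑ s, eval x (pderiv s p) • ContinuousLinearMap.proj s

lemma polyDeriv_apply (p : MvPolynomial σ ℝ) (x v : σ → ℝ) :
    polyDeriv p x v = ∑ s, eval x (pderiv s p) * v s := by
  simp [polyDeriv]

lemma polyDeriv_add (p q : MvPolynomial σ ℝ) (x : σ → ℝ) :
    polyDeriv (p + q) x = polyDeriv p x + polyDeriv q x := by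
  simp [polyDeriv, add_smul, Finset.sum_add_distrib]

lemma polyDeriv_mul_X (p : MvPolynomial σ ℝ) (s : σ) (x : σ → ℝ) :
    polyDeriv (p * X s) x =
      eval x p • ContinuousLinearMap.proj s + x s • polyDeriv p x := by
  classical
  ext v
  simp only [polyDeriv_apply, Derivation.leibniz, add_apply,
    smul_apply, ContinuousLinearMap.proj_apply, smul_eq_mul, pderiv_X,
    map_add, map_mul, eval_X, add_mul, Finset.sum_add_distrib, Finset.mul_sum]
  congr 1
  · rw [Finset.sum_eq_single s]
    · simp
    · intro b _ hb
      simp [hb]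
    · simp
  · exact Finset.sum_congr rfl fun _ _ => by ring

lemma hasStrictFDerivAt_eval (p : MvPolynomial σ ℝ) (x : σ → ℝ) :
    HasStrictFDerivAt (fun y => eval y p) (polyDeriv p x) x := by
  induction p using MvPolynomial.induction_on with
  | C a => simpa [polyDeriv] using hasStrictFDerivAt_const a x
  | add p q hp hq =>
    rw [polyDeriv_add]
    simp only [map_add]
    exact hp.add hq
  | mul_X p s hp =>
    rw [polyDeriv_mul_X]
    simp only [map_mul, eval_X]
    exact hp.mul (ContinuousLinearMap.proj (R := ℝ) (φ := fun _ : σ => ℝ) s).hasStrictFDerivAt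

/-- First-order Taylor expansion of a polynomial. -/
lemma translate_sub_mem (p : MvPolynomial σ ℝ) (x : σ → ℝ) :
    translate x p - C (eval x p) - ∑ s, C (eval x (pderiv s p)) * X s ∈ idealOfVars σ ℝ ^ 2 := by
  classical
  induction p using MvPolynomial.induction_on with
  | C a => simp [translate]
  | add p q hp hq =>
    have := add_mem hp hq
    simp only [map_add, add_mul, Finset.sum_add_distrib]
    convert this using 1
    ring
  | mul_X p s hp =>
    have hsum : ∑ i, C (eval x (pderiv i (p * X s))) * X i =
        C (eval x p) * X s + C (x s) * ∑ i, C (eval x (pderiv i p)) * X i := by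
      simp only [Derivation.leibniz, smul_eq_mul, pderiv_X, map_add, map_mul, eval_X, add_mul,
        Finset.sum_add_distrib, Finset.mul_sum]
      congr 1
      · rw [Finset.sum_eq_single s]
        · simp
        · intro b _ hb
          simp [hb]
        · simp
      · exact Finset.sum_congr rfl fun _ _ => by ring
    have h1 : ∑ i, C (eval x (pderiv i p)) * X i ∈ idealOfVars σ ℝ :=
      Ideal.sum_mem _ fun i _ => Ideal.mul_mem_left _ _ (X_mem_pow_one i)
    have h2 := add_mem (Ideal.mul_mem_left _ (C (x s) + X s) hp)
      (show (∑ i, C (eval x (pderiv i p)) * X i) * X s ∈ idealOfVars σ ℝ ^ 2 by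
        rw [pow_two]; exact Ideal.mul_mem_mul h1 (X_mem_pow_one s))
    rw [hsum]
    convert h2 using 1
    simp only [map_mul, eval_X, translate_X]
    ring

lemma isHomogeneous_linear (c : σ → ℝ) : (∑ s, C (c s) * X s : MvPolynomial σ ℝ).IsHomogeneous 1 :=
  IsHomogeneous.sum _ _ _ fun _ _ => isHomogeneous_C_mul_X _ _

lemma eval_smul_of_isHomogeneous {p : MvPolynomial σ ℝ} {n : ℕ} (hp : p.IsHomogeneous n) (a : ℝ)
    (s : σ → ℝ) : eval (a • s) p = a ^ n * eval s p := by
  rw [eval_eq', eval_eq', Finset.mul_sum]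
  refine Finset.sum_congr rfl fun d hd => ?_
  have hdeg : ∑ i, d i = n := by
    rw [← Finsupp.degree_eq_sum]
    by_contra h
    exact (mem_support_iff.1 hd) (hp.coeff_eq_zero h)
  simp only [Pi.smul_apply, smul_eq_mul, mul_pow, Finset.prod_mul_distrib,
    Finset.prod_pow_eq_pow_sum, hdeg]
  ring

/-- Limits of rescaled secants are zeros of the initial form. -/
lemma eval_minFormAt_eq_zero {S : Set (σ → ℝ)} {f : MvPolynomial σ ℝ} {x t : σ → ℝ} (hx : x ∈ S)
    (hf : ∀ y ∈ S, eval y f = 0) (ht : t ∈ tangentCone S x) : eval t (minFormAt x f) = 0 := by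
  rw [minFormAt_eq]
  set F := translate x f with hF
  by_cases hF0 : F = 0
  · simp [hF0, minForm_zero]
  obtain ⟨k, hk, hk0⟩ := exists_mem_pow_homogeneousComponent_ne_zero hF0
  rw [minForm_eq hk hk0]
  have hhom (j : ℕ) (a : ℝ) (s : σ → ℝ) :
      eval (a • s) (homogeneousComponent j F) = a ^ j * eval s (homogeneousComponent j F) :=
     eval_smul_of_isHomogeneous (homogeneousComponent_isHomogeneous j F) a s
  -- The zero vector is separate because the scaling factors need not tend to infinity there. The
  -- initial form has positive degree, as the constant term of F is f(x) = 0.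
  by_cases ht0 : t = 0
  · have hkpos : k ≠ 0 := by
      rintro rfl
      apply hk0
      have : eval 0 F = 0 := by rw [hF, eval_translate, add_zero, hf x hx]
      rw [homogeneousComponent_zero]
      rw [← constantCoeff_eq] 
      simp [← this, constantCoeff]
    have := hhom k 0 t
    simpa [ht0, hkpos] using this
  obtain ⟨α, y, hα, hy, hyx, hlim⟩ := ht
  have hα0 : Tendsto (fun n => (α n)⁻¹) atTop (𝓝 0) := by
    have h1 : Tendsto (fun n => ‖y n - x‖ / ‖α n • (y n - x)‖) atTop (𝓝 (0 / ‖t‖)) := by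
      refine Tendsto.div ?_ hlim.norm (norm_ne_zero_iff.2 ht0)
      simpa using (hyx.sub_const x).norm
    rw [zero_div] at h1
    refine h1.congr' ?_
    filter_upwards [hlim.eventually_ne ht0] with n hn
    have hn' : ‖y n - x‖ ≠ 0 := by
      intro h0
      rw [norm_eq_zero] at h0
      simp [h0] at hn
    rw [norm_smul, Real.norm_of_nonneg (hα n).le]
    field_simp
  -- F(y_n - x) = 0 multiplied by α_n^k: by homogeneity the degree j part acquires the factor α_n^(k
  -- - j), so only j = k survives in the limit. The guard handles j < k, where the component is zero
  -- and the subtraction j - k is truncated.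
  have hzero (n) : ∑ j ∈ Finset.range (F.totalDegree + 1), (if j < k then 0 else
      (α n)⁻¹ ^ (j - k) * eval (α n • (y n - x)) (homogeneousComponent j F)) = 0 := by
    have h1 : eval (y n - x) F = 0 := by rw [hF, eval_translate, add_sub_cancel, hf _ (hy n)]
    rw [← sum_homogeneousComponent F, map_sum] at h1
    have h2 := congrArg (α n ^ k * ·) h1
    simp only [Finset.mul_sum, mul_zero] at h2
    refine (Finset.sum_congr rfl fun j _ => ?_).trans h2
    split_ifs with hjk
    · simp [mem_pow_idealOfVars_iff_homogeneousComponent.1 hk j hjk]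
    · push Not at hjk
      rw [hhom]
      obtain ⟨i, rfl⟩ := Nat.exists_eq_add_of_le hjk
      rw [Nat.add_sub_cancel_left, pow_add, inv_pow]
      have := (hα n).ne'
      field_simp
  have hsum : Tendsto (fun n => ∑ j ∈ Finset.range (F.totalDegree + 1), (if j < k then 0 else
      (α n)⁻¹ ^ (j - k) * eval (α n • (y n - x)) (homogeneousComponent j F))) atTop
      (𝓝 (∑ j ∈ Finset.range (F.totalDegree + 1), (if j < k then 0 else
      0 ^ (j - k) * eval t (homogeneousComponent j F)))) := by
    refine tendsto_finsetSum _ fun j _ => ?_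
    split_ifs
    · exact tendsto_const_nhds
    · exact (hα0.pow _).mul (((MvPolynomial.continuous_eval _).tendsto t).comp hlim)
  simp only [hzero] at hsum
  have h0 := tendsto_nhds_unique hsum tendsto_const_nhds
  rw [Finset.sum_eq_single k] at h0
  · simpa using h0
  · intro j _ hj
    split_ifs with hjk
    · rfl
    · have : j - k ≠ 0 := by omega
      simp [this]
  · intro hnot
    have : F.totalDegree < k := by simpa using hnot
    simp [homogeneousComponent_eq_zero _ _ this]

end Polynomials

/-! ### Tangent cone and algebraic cone of a general relation -/

section Models

open Filter

variable {m : ℕ} {L : Set (CICouple m)}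

/-- The determinant of a couple as a polynomial in the entries of the generic matrix. -/
noncomputable def ciPoly (c : CICouple m) : MvPolynomial (Pairs m) ℝ :=
  ciDet (corrMatrix (X : Pairs m → MvPolynomial (Pairs m) ℝ)) c

lemma eval_ciPoly (r : Pairs m → ℝ) (c : CICouple m) :
    eval r (ciPoly c) = ciDet (corrMatrix r) c := by
  rw [ciPoly, map_ciDet]
  simp

lemma ciPoly_mem {c : CICouple m} (hc : c ∈ L) : ciPoly c ∈ ciIdeal L :=
  Ideal.subset_span ⟨c, hc, rfl⟩

lemma eval_eq_zero_of_mem_ciIdeal {f : MvPolynomial (Pairs m) ℝ} (hf : f ∈ ciIdeal L)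
    {r : Pairs m → ℝ} (hr : r ∈ Vcor L) : eval r f = 0 := by
  have : ciIdeal L ≤ RingHom.ker (eval r) := by
    rw [ciIdeal, Ideal.span_le]
    rintro _ ⟨c, hc, rfl⟩
    exact (eval_ciPoly r c).trans (hr.2 c hc)
  exact this hf

theorem tangentCone_subset_algCone {x : Pairs m → ℝ} (hx : x ∈ Vcor L) :
    tangentCone (Vcor L) x ⊆ algCone L x := by
  intro t ht f hf
  have : coneIdeal L x ≤ RingHom.ker (eval t) := by
    rw [coneIdeal, Ideal.span_le]
    rintro _ ⟨f, hf, rfl⟩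
    exact eval_minFormAt_eq_zero hx (fun y hy => eval_eq_zero_of_mem_ciIdeal hf hy) ht
  exact this hf

/-- Positivity of the quadratic form on the compact unit sphere persists under small changes of the
entries, and homogeneity extends it to all nonzero vectors. Curves through a correlation matrix
therefore need only be tested on the determinants. -/
lemma isOpen_posDef : IsOpen {r : Pairs m → ℝ | (corrMatrix r).PosDef} := by
  rw [isOpen_iff_mem_nhds]
  intro x hx
  have hcont (i j : Fin m) : Continuous fun r : Pairs m → ℝ => corrMatrix r i j := by
    simp only [corrMatrix, Matrix.of_apply]
    split_ifs <;> fun_prop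
  have hform : Continuous fun z : (Pairs m → ℝ) × (Fin m → ℝ) =>
      star z.2 ⬝ᵥ (corrMatrix z.1).mulVec z.2 := by
    simp only [dotProduct, Matrix.mulVec, Pi.star_apply, star_trivial]
    have := fun i j => (hcont i j).comp (continuous_fst (X := Pairs m → ℝ) (Y := Fin m → ℝ))
    simp only [Function.comp_def] at this
    fun_prop
  have key : ∀ᶠ r in 𝓝 x, ∀ v ∈ Metric.sphere (0 : Fin m → ℝ) 1,
      0 < star v ⬝ᵥ (corrMatrix r).mulVec v := by
    refine (isCompact_sphere _ _).eventually_forall_of_forall_eventually fun v hv => ?_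
    refine hform.continuousAt.eventually (lt_mem_nhds ?_)
    exact Matrix.PosDef.dotProduct_mulVec_pos hx (ne_zero_of_mem_unit_sphere ⟨v, hv⟩)
  filter_upwards [key] with r hr
  refine Matrix.PosDef.of_dotProduct_mulVec_pos ?_ fun v hv => ?_
  · ext i j
    rcases lt_trichotomy i j with h | rfl | h
    · simp [corrMatrix, h, h.not_gt]
    · simp [corrMatrix]
    · simp [corrMatrix, h, h.not_gt]
  · have hn : 0 < ‖v‖ := norm_pos_iff.2 hv
    have := hr (‖v‖⁻¹ • v) (by simp [norm_smul, hn.ne'])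
    rw [Matrix.mulVec_smul, star_smul, smul_dotProduct, dotProduct_smul] at this
    have h2 : 0 < ‖v‖⁻¹ := inv_pos.2 hn
    simp only [star_trivial, smul_eq_mul] at this ⊢
    rw [mul_pos_iff_of_pos_left h2, mul_pos_iff_of_pos_left h2] at this
    exact this

/-- A curve in the zero set of the determinants that starts at a correlation matrix. -/
lemma mem_tangentCone_Vcor {x t : Pairs m → ℝ} (hx : x ∈ Vcor L) {y : ℝ → Pairs m → ℝ}
    (hy : HasDerivAt y t 0) (h0 : y 0 = x)
    (hL : ∀ᶠ τ in 𝓝 0, ∀ c ∈ L, ciDet (corrMatrix (y τ)) c = 0) :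
    t ∈ tangentCone (Vcor L) x := by
  refine mem_tangentCone_of_curve hy h0 (nhdsWithin_le_nhds ?_)
  have : ∀ᶠ τ in 𝓝 0, y τ ∈ {r : Pairs m → ℝ | (corrMatrix r).PosDef} :=
    hy.continuousAt.eventually (isOpen_posDef.mem_nhds (by rw [h0]; exact hx.1))
  filter_upwards [this, hL] with τ h1 h2 using ⟨h1, h2⟩

/-- The value p(x) is zero, so the linear Taylor part of p at x belongs to the cone ideal. -/
lemma polyDeriv_eq_zero_of_mem_algCone {p : MvPolynomial (Pairs m) ℝ} (hp : p ∈ ciIdeal L)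
    {x t : Pairs m → ℝ} (hx : x ∈ Vcor L) (ht : t ∈ algCone L x) : polyDeriv p x t = 0 := by
  have h := translate_sub_mem p x
  rw [eval_eq_zero_of_mem_ciIdeal hp hx, map_zero, sub_zero] at h
  simpa [polyDeriv_apply] using ht _ (mem_coneIdeal hp (isHomogeneous_linear _) h)

/-- At a point where the gradients of the defining determinants are linearly independent, the
algebraic cone is contained in the tangent cone. -/
theorem algCone_subset_tangentCone_of_independent {n : ℕ} {c : Fin n → CICouple m}
    {x : Pairs m → ℝ} (hx : x ∈ Vcor (Set.range c))
    (hind : ∀ l : Fin n → ℝ, (∀ s, ∑ i, l i * eval x (pderiv s (ciPoly (c i))) = 0) → l = 0) :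
    algCone (Set.range c) x ⊆ tangentCone (Vcor (Set.range c)) x := by
  intro t ht
  have hF : HasStrictFDerivAt (fun y i => eval y (ciPoly (c i)))
      (ContinuousLinearMap.pi fun i => polyDeriv (ciPoly (c i)) x) x :=
    hasStrictFDerivAt_pi.2 fun i => hasStrictFDerivAt_eval _ x
  set F := fun (y : Pairs m → ℝ) i => eval y (ciPoly (c i))
  set F' := ContinuousLinearMap.pi fun i => polyDeriv (ciPoly (c i)) x
  -- A nonzero functional vanishing on the range of the Jacobian would be a linear relation between
  -- the gradients.
  have hsurj : F'.range = ⊤ := by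
    by_contra hne
    obtain ⟨ψ, hψ0, hψ⟩ := Submodule.exists_le_ker_of_lt_top _ (lt_top_iff_ne_top.2 hne)
    apply hψ0
    have hl := hind (fun i => ψ (Pi.single i 1)) fun s => by
      have h1 : ψ (F' (Pi.single s 1)) = 0 := hψ ⟨Pi.single s 1, rfl⟩
      rw [LinearMap.pi_apply_eq_sum_univ ψ] at h1
      rw [← h1]
      refine Finset.sum_congr rfl fun i _ => ?_
      have h2 : F' (Pi.single s 1) i = eval x (pderiv s (ciPoly (c i))) := by
        simp [F', polyDeriv_apply, Pi.single_apply]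
      rw [h2, smul_eq_mul, mul_comm]
      congr 2
      ext j
      simp [Pi.single_apply, eq_comm]
    refine LinearMap.pi_ext' fun i => LinearMap.ext_ring ?_
    simpa using congrFun hl i
  have htk : t ∈ F'.ker := by
    rw [LinearMap.mem_ker]
    ext i
    exact polyDeriv_eq_zero_of_mem_algCone (ciPoly_mem (Set.mem_range_self i)) hx ht
  -- The implicit function carries the line spanned by t in the kernel to a curve in the fibre of F
  -- through x, with velocity t.
  let w : F'.ker := ⟨t, htk⟩
  have hline : HasDerivAt (fun τ : ℝ => τ • w) w 0 := by
    simpa using (hasDerivAt_id (0 : ℝ)).smul_const w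
  have hline0 : Tendsto (fun τ : ℝ => τ • w) (𝓝 0) (𝓝 0) := by
    simpa using hline.continuousAt.tendsto
  have himp := (hF.to_implicitFunction hsurj).hasFDerivAt
  have himp' : HasFDerivAt (hF.implicitFunction F F' hsurj (F x)) F'.ker.subtypeL ((0 : ℝ) • w) := by
    rw [zero_smul]
    exact himp
  have hcurve : HasDerivAt (fun τ : ℝ => hF.implicitFunction F F' hsurj (F x) (τ • w)) t 0 :=
    HasFDerivAt.comp_hasDerivAt (f := fun τ : ℝ => τ • w) 0 himp' hline
  refine mem_tangentCone_Vcor hx hcurve (by simp) ?_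
  have hev := hF.map_implicitFunction_eq hsurj
  have hpair : Tendsto (fun τ : ℝ => (F x, τ • w)) (𝓝 0) (𝓝 (F x, 0)) :=
    tendsto_const_nhds.prodMk_nhds hline0
  filter_upwards [hpair.eventually hev] with τ hτ
  rintro _ ⟨i, rfl⟩
  rw [← eval_ciPoly]
  exact (congrFun hτ i).trans ((eval_ciPoly x (c i)).trans (hx.2 _ ⟨i, rfl⟩))

end Models

/-! ### The determinants of the couples on four variables -/

section Determinants

variable {A : Type*} [CommRing A]

lemma ciDet_empty {m : ℕ} (R : Matrix (Fin m) (Fin m) A) (c : CICouple m) (hc : c.C = ∅) :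
    ciDet R c = R c.i c.j := by
  obtain ⟨i, j, C, h1, h2, h3⟩ := c
  subst hc
  let _ : Unique (Option (∅ : Finset (Fin m))) := ⟨⟨none⟩, fun a => by
    rcases a with _ | ⟨_, h⟩
    · rfl
    · simp at h⟩
  rw [ciDet, Matrix.det_unique]
  rfl

lemma ciDet_singleton {m : ℕ} (R : Matrix (Fin m) (Fin m) A) (c : CICouple m) (k : Fin m)
    (hc : c.C = {k}) : ciDet R c = R c.i c.j * R k k - R c.i k * R k c.j := by
  obtain ⟨i, j, C, h1, h2, h3⟩ := c
  subst hc
  let e : Fin 2 ≃ Option ({k} : Finset (Fin m)) :=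
    Equiv.ofBijective ![none, some ⟨k, by simp⟩] ⟨by
      intro a b
      fin_cases a <;> fin_cases b <;> simp, by
      rintro (_ | ⟨a, ha⟩)
      · exact ⟨0, rfl⟩
      · obtain rfl := Finset.mem_singleton.1 ha
        exact ⟨1, rfl⟩⟩
  rw [ciDet, ← Matrix.det_submatrix_equiv_self e, Matrix.det_fin_two]
  rfl

lemma ciDet_pair {m : ℕ} (R : Matrix (Fin m) (Fin m) A) (c : CICouple m) {k l : Fin m}
    (hkl : k ≠ l) (hc : c.C = {k, l}) : ciDet R c =
      R c.i c.j * R k k * R l l - R c.i c.j * R k l * R l k - R c.i k * R k c.j * R l l +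
      R c.i k * R k l * R l c.j + R c.i l * R k c.j * R l k - R c.i l * R k k * R l c.j := by
  obtain ⟨i, j, C, h1, h2, h3⟩ := c
  subst hc
  let e : Fin 3 ≃ Option ({k, l} : Finset (Fin m)) :=
    Equiv.ofBijective ![none, some ⟨k, by simp⟩, some ⟨l, by simp⟩] ⟨by
      intro a b
      fin_cases a <;> fin_cases b <;> simp [hkl, hkl.symm], by
      rintro (_ | ⟨a, ha⟩)
      · exact ⟨0, rfl⟩
      · rcases Finset.mem_insert.1 ha with rfl | h
        · exact ⟨1, rfl⟩
        · obtain rfl := Finset.mem_singleton.1 h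
          exact ⟨2, rfl⟩⟩
  rw [ciDet, ← Matrix.det_submatrix_equiv_self e, Matrix.det_fin_three]
  rfl

variable (r : Pairs 4 → A)

lemma corrMatrix_diag {m : ℕ} (r : Pairs m → A) (i : Fin m) : corrMatrix r i i = 1 := by
  simp [corrMatrix]

lemma corrMatrix_of_lt {m : ℕ} (r : Pairs m → A) {i j : Fin m} (h : i < j) :
    corrMatrix r i j = r ⟨(i, j), h⟩ := by
  simp [corrMatrix, h]

lemma corrMatrix_of_gt {m : ℕ} (r : Pairs m → A) {i j : Fin m} (h : j < i) :
    corrMatrix r i j = r ⟨(j, i), h⟩ := by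
  simp [corrMatrix, h, h.not_gt]

lemma ciDet_14 : ciDet (corrMatrix r) { i := 0, j := 3, C := ∅ } = r e14 :=
  ciDet_empty _ _ rfl

lemma ciDet_23 : ciDet (corrMatrix r) { i := 1, j := 2, C := ∅ } = r e23 :=
  ciDet_empty _ _ rfl

lemma ciDet_14_2 : ciDet (corrMatrix r) { i := 0, j := 3, C := {1} } = r e14 - r e12 * r e24 := by
  rw [ciDet_singleton _ _ 1 rfl, corrMatrix_diag, mul_one]
  rfl

lemma ciDet_14_3 : ciDet (corrMatrix r) { i := 0, j := 3, C := {2} } = r e14 - r e13 * r e34 := by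
  rw [ciDet_singleton _ _ 2 rfl, corrMatrix_diag, mul_one]
  rfl

lemma ciDet_12_3 : ciDet (corrMatrix r) { i := 0, j := 1, C := {2} } = r e12 - r e13 * r e23 := by
  rw [ciDet_singleton _ _ 2 rfl, corrMatrix_diag, mul_one]
  rfl

lemma ciDet_12_4 : ciDet (corrMatrix r) { i := 0, j := 1, C := {3} } = r e12 - r e14 * r e24 := by
  rw [ciDet_singleton _ _ 3 rfl, corrMatrix_diag, mul_one]
  rfl

lemma ciDet_34_1 : ciDet (corrMatrix r) { i := 2, j := 3, C := {0} } = r e34 - r e13 * r e14 := by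
  rw [ciDet_singleton _ _ 0 rfl, corrMatrix_diag, mul_one]
  rfl

lemma ciDet_14_23 : ciDet (corrMatrix r) { i := 0, j := 3, C := {1, 2} } =
    r e14 * (1 - r e23 * r e23) - r e12 * r e24 - r e13 * r e34 +
      r e12 * r e23 * r e34 + r e13 * r e23 * r e24 := by
  rw [ciDet_pair _ _ (k := 1) (l := 2) (by decide) rfl, corrMatrix_diag, corrMatrix_diag]
  change r e14 * 1 * 1 - r e14 * r e23 * r e23 - r e12 * r e24 * 1 +
    r e12 * r e23 * r e34 + r e13 * r e24 * r e23 - r e13 * 1 * r e34 = _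
  ring

lemma ciDet_23_14 : ciDet (corrMatrix r) { i := 1, j := 2, C := {0, 3} } =
    r e23 * (1 - r e14 * r e14) - r e12 * r e13 - r e24 * r e34 +
      r e12 * r e14 * r e34 + r e13 * r e14 * r e24 := by
  rw [ciDet_pair _ _ (k := 0) (l := 3) (by decide) rfl, corrMatrix_diag, corrMatrix_diag]
  change r e23 * 1 * 1 - r e23 * r e14 * r e14 - r e12 * r e13 * 1 +
    r e12 * r e14 * r e34 + r e24 * r e13 * r e14 - r e24 * 1 * r e34 = _
  ring

end Determinants

/-! ### Inequalities from principal minors -/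

section Bounds

lemma sq_lt_one_of_posDef {m : ℕ} {r : Pairs m → ℝ} (h : (corrMatrix r).PosDef) (p : Pairs m) :
    r p ^ 2 < 1 := by
  obtain ⟨⟨i, j⟩, hij⟩ := p
  have hij' : i < j := hij
  have := (h.submatrix (e := ![i, j]) (by
    intro a b
    fin_cases a <;> fin_cases b <;> simp [hij'.ne, hij'.ne'])).det_pos
  rw [Matrix.det_fin_two] at this
  simp only [Matrix.submatrix_apply, Matrix.cons_val_zero, Matrix.cons_val_one, corrMatrix_diag,
    corrMatrix_of_lt r hij', corrMatrix_of_gt r hij'] at this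
  nlinarith

/-- Principal minors of size three with a vanishing entry. -/
lemma minor_pos_of_posDef {m : ℕ} {r : Pairs m → ℝ} (h : (corrMatrix r).PosDef) {i j k : Fin m}
    (hij : i ≠ j) (hik : i ≠ k) (hjk : j ≠ k) (h0 : corrMatrix r i j = 0) :
    0 < 1 - corrMatrix r i k ^ 2 - corrMatrix r j k ^ 2 := by
  have hd := (h.submatrix (e := ![i, j, k]) (by
    intro a b
    fin_cases a <;> fin_cases b <;> simp [hij, hij.symm, hik, hik.symm, hjk, hjk.symm])).det_pos
  have hs (a b) : corrMatrix r b a = corrMatrix r a b := by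
    simpa using h.isHermitian.apply a b
  rw [Matrix.det_fin_three] at hd
  simp only [Matrix.submatrix_apply, Matrix.cons_val_zero, Matrix.cons_val_one,
    Matrix.cons_val, corrMatrix_diag, hs i j, hs i k, hs j k, h0] at hd
  nlinarith

end Bounds

/-! ### Coordinates on four variables -/

section Coordinates

variable {A : Type*}

/-- The vector with the given entries `12, 13, 14, 23, 24, 34`. -/
def entries (a b c d e f : A) : Pairs 4 → A := fun p =>
  -- The positions on and below the diagonal are never read, since pairs satisfy i < j; `a` is only
  -- a filler there.
  (![![a, a, b, c], ![a, a, d, e], ![a, a, a, f], ![a, a, a, a]] : Fin 4 → Fin 4 → A) p.1.1 p.1.2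

variable (a b c d e f : A)

@[simp] lemma entries_e12 : entries a b c d e f e12 = a := rfl
@[simp] lemma entries_e13 : entries a b c d e f e13 = b := rfl
@[simp] lemma entries_e14 : entries a b c d e f e14 = c := rfl
@[simp] lemma entries_e23 : entries a b c d e f e23 = d := rfl
@[simp] lemma entries_e24 : entries a b c d e f e24 = e := rfl
@[simp] lemma entries_e34 : entries a b c d e f e34 = f := rfl

lemma entries_apply : entries a b c d e f e12 = a ∧ entries a b c d e f e13 = b ∧
    entries a b c d e f e14 = c ∧ entries a b c d e f e23 = d ∧ entries a b c d e f e24 = e ∧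
    entries a b c d e f e34 = f :=
  ⟨rfl, rfl, rfl, rfl, rfl, rfl⟩

lemma forall_pairs {P : Pairs 4 → Prop} :
    (∀ p, P p) ↔ P e12 ∧ P e13 ∧ P e14 ∧ P e23 ∧ P e24 ∧ P e34 := by
  refine ⟨fun h => ⟨h _, h _, h _, h _, h _, h _⟩, ?_⟩
  rintro ⟨h1, h2, h3, h4, h5, h6⟩ ⟨⟨i, j⟩, hij⟩
  fin_cases i <;> fin_cases j <;>
    first
    | exact absurd hij (by decide)
    | assumption

lemma entries_ext {r s : Pairs 4 → A} (h12 : r e12 = s e12) (h13 : r e13 = s e13)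
    (h14 : r e14 = s e14) (h23 : r e23 = s e23) (h24 : r e24 = s e24) (h34 : r e34 = s e34) :
    r = s :=
  funext (forall_pairs.2 ⟨h12, h13, h14, h23, h24, h34⟩)

lemma single_e14 [Zero A] : (Pi.single e14 c : Pairs 4 → A) = entries 0 0 c 0 0 0 :=
  entries_ext rfl rfl rfl rfl rfl rfl

lemma single_e34 [Zero A] : (Pi.single e34 f : Pairs 4 → A) = entries 0 0 0 0 0 f :=
  entries_ext rfl rfl rfl rfl rfl rfl

lemma hasDerivAt_entries {a b c d e f : ℝ → ℝ} {t : Pairs 4 → ℝ} {τ : ℝ}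
    (h12 : HasDerivAt a (t e12) τ) (h13 : HasDerivAt b (t e13) τ) (h14 : HasDerivAt c (t e14) τ)
    (h23 : HasDerivAt d (t e23) τ) (h24 : HasDerivAt e (t e24) τ) (h34 : HasDerivAt f (t e34) τ) :
    HasDerivAt (fun τ => entries (a τ) (b τ) (c τ) (d τ) (e τ) (f τ)) t τ :=
  hasDerivAt_pi.2 (forall_pairs.2 ⟨h12, h13, h14, h23, h24, h34⟩)

/-- A scaled coordinate of a curve through the origin. -/
lemma hasDerivAt_mul_of_continuousAt {g : ℝ → ℝ} (hg : ContinuousAt g 0) {s : ℝ} (h0 : g 0 = s) :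
    HasDerivAt (fun τ => τ * g τ) s 0 := by
  -- The difference quotient of τ * g τ at 0 is g τ itself, so continuity of g suffices.
  rw [hasDerivAt_iff_tendsto_slope]
  have : Filter.Tendsto g (𝓝[≠] 0) (𝓝 s) := h0 ▸ hg.tendsto.mono_left nhdsWithin_le_nhds
  refine this.congr' ?_
  filter_upwards [self_mem_nhdsWithin] with τ hτ
  have : τ ≠ 0 := hτ
  simp [slope_def_field, this]

lemma hasDerivAt_const_add_mul (c s : ℝ) : HasDerivAt (fun τ : ℝ => c + τ * s) s 0 := by
  simpa using ((hasDerivAt_id (0 : ℝ)).mul_const s).const_add c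

lemma hasDerivAt_zero_of_eq {s : ℝ} (h : s = 0) : HasDerivAt (fun _ : ℝ => (0 : ℝ)) s 0 := by
  rw [h]
  exact hasDerivAt_const _ _

@[simp] lemma translate_zero {σ : Type*} (p : MvPolynomial σ ℝ) : translate 0 p = p := by
  simp [translate]

lemma ne_zero_of_eval {σ : Type*} {p : MvPolynomial σ ℝ} (x : σ → ℝ) (h : eval x p ≠ 0) : p ≠ 0 :=
  fun h0 => h (by simp [h0])

lemma isHomogeneous_X_mul_X {σ : Type*} (s t : σ) :
    (X s * X t : MvPolynomial σ ℝ).IsHomogeneous 2 :=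
  (isHomogeneous_X ℝ s).mul (isHomogeneous_X ℝ t)

lemma ciPoly_14 : ciPoly (m := 4) { i := 0, j := 3, C := ∅ } = X e14 := ciDet_14 X

lemma ciPoly_23 : ciPoly (m := 4) { i := 1, j := 2, C := ∅ } = X e23 := ciDet_23 X

lemma ciPoly_14_2 : ciPoly (m := 4) { i := 0, j := 3, C := {1} } = X e14 - X e12 * X e24 :=
  ciDet_14_2 X

lemma ciPoly_14_3 : ciPoly (m := 4) { i := 0, j := 3, C := {2} } = X e14 - X e13 * X e34 :=
  ciDet_14_3 X

lemma ciPoly_12_3 : ciPoly (m := 4) { i := 0, j := 1, C := {2} } = X e12 - X e13 * X e23 :=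
  ciDet_12_3 X

lemma ciPoly_12_4 : ciPoly (m := 4) { i := 0, j := 1, C := {3} } = X e12 - X e14 * X e24 :=
  ciDet_12_4 X

lemma ciPoly_34_1 : ciPoly (m := 4) { i := 2, j := 3, C := {0} } = X e34 - X e13 * X e14 :=
  ciDet_34_1 X

lemma ciPoly_14_23 : ciPoly (m := 4) { i := 0, j := 3, C := {1, 2} } =
    X e14 * (1 - X e23 * X e23) - X e12 * X e24 - X e13 * X e34 +
      X e12 * X e23 * X e34 + X e13 * X e23 * X e24 := ciDet_14_23 X

lemma ciPoly_23_14 : ciPoly (m := 4) { i := 1, j := 2, C := {0, 3} } =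
    X e23 * (1 - X e14 * X e14) - X e12 * X e13 - X e24 * X e34 +
      X e12 * X e14 * X e34 + X e13 * X e14 * X e24 := ciDet_23_14 X

lemma zero_mem_Vcor {L : Set (CICouple 4)}
    (hL : ∀ c ∈ L, ciDet (corrMatrix (0 : Pairs 4 → ℝ)) c = 0) : (0 : Pairs 4 → ℝ) ∈ Vcor L := by
  refine ⟨?_, hL⟩
  have : corrMatrix (0 : Pairs 4 → ℝ) = 1 := by
    ext i j
    rcases lt_trichotomy i j with h | rfl | h
    · simp [corrMatrix, h, h.ne]
    · simp [corrMatrix]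
    · simp [corrMatrix, h, h.not_gt, h.ne']
  rw [this]
  exact Matrix.PosDef.one

lemma mul_X_mul_X_mem {σ : Type*} (p : MvPolynomial σ ℝ) (s t : σ) :
    p * (X s * X t) ∈ idealOfVars σ ℝ ^ 2 :=
  Ideal.mul_mem_left _ _ (X_mul_X_mem s t)

lemma mul_X_mul_X_mul_X_mem {σ : Type*} (p : MvPolynomial σ ℝ) (s t u : σ) :
    p * (X s * X t * X u) ∈ idealOfVars σ ℝ ^ 3 :=
  Ideal.mul_mem_left _ _ (X_mul_X_mul_X_mem s t u)

/-- Determination of a cone ideal: `f₁, f₂, f` are elements of the ideal with initial forms `X s₁`,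
`X s₂`, `q` at `x`, and `r k` is a parametrization up to order `k`, with values near `x`, of the
smooth variety defined by the elements with linear initial forms, on which the determinants become
multiples of a polynomial with initial form `q`. -/
lemma coneIdeal_eq_span {L : Set (CICouple 4)} {x : Pairs 4 → ℝ} {s₁ s₂ : Pairs 4}
    {f₁ f₂ f q : MvPolynomial (Pairs 4) ℝ} (hq : q.IsHomogeneous 2) (hq0 : q ≠ 0)
    (hf₁ : f₁ ∈ ciIdeal L) (hf₂ : f₂ ∈ ciIdeal L) (hf : f ∈ ciIdeal L)
    (h₁ : translate x f₁ - X s₁ ∈ idealOfVars (Pairs 4) ℝ ^ 2)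
    (h₂ : translate x f₂ - X s₂ ∈ idealOfVars (Pairs 4) ℝ ^ 2)
    (h : translate x f - q ∈ idealOfVars (Pairs 4) ℝ ^ 3)
    (r : ℕ → Pairs 4 → MvPolynomial (Pairs 4) ℝ) (g : MvPolynomial (Pairs 4) ℝ)
    (hr₁ : ∀ k, r k s₁ - C (x s₁) ∈ idealOfVars (Pairs 4) ℝ ^ 2)
    (hr₂ : ∀ k, r k s₂ - C (x s₂) ∈ idealOfVars (Pairs 4) ℝ ^ 2)
    (hr : ∀ k s, s ≠ s₁ → s ≠ s₂ → r k s = C (x s) + X s)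
    (hg : g - q ∈ idealOfVars (Pairs 4) ℝ ^ 3)
    (hL : ∀ k, ∀ c ∈ L, ∃ u, ciDet (corrMatrix (r k)) c - u * g ∈
      idealOfVars (Pairs 4) ℝ ^ (k + 1)) :
    coneIdeal L x = Ideal.span {X s₁, X s₂, q} := by
  apply le_antisymm
  · refine coneIdeal_le (Z := {s₁, s₂}) (n := 2) (q := q) ?_ (Ideal.subset_span (by simp)) hq hq0
      fun k => ⟨fun s => r k s - C (x s), g, ?_, ?_, hg, ?_⟩
    · rintro s (rfl | rfl) <;> exact Ideal.subset_span (by simp)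
    · rintro s (rfl | rfl)
      exacts [hr₁ k, hr₂ k]
    · intro s hs
      have hs' : s ≠ s₁ ∧ s ≠ s₂ := by simpa using hs
      simp [hr k s hs'.1 hs'.2]
    · simpa using hL k
  · rw [Ideal.span_le]
    rintro _ (rfl | rfl | rfl)
    exacts [mem_coneIdeal hf₁ (isHomogeneous_X _ _) h₁, mem_coneIdeal hf₂ (isHomogeneous_X _ _) h₂,
      mem_coneIdeal hf hq h]

lemma exists_sub_mul_mem {σ : Type*} {p g : MvPolynomial σ ℝ} (u : MvPolynomial σ ℝ)
    (h : p = u * g) (k : ℕ) : ∃ u, p - u * g ∈ idealOfVars σ ℝ ^ k :=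
  ⟨u, by rw [h, sub_self]; exact zero_mem _⟩

lemma algCone_subset_tangentCone_of_independent_two {c₁ c₂ : CICouple 4}
    {p₁ p₂ : MvPolynomial (Pairs 4) ℝ} (e₁ : ciPoly c₁ = p₁) (e₂ : ciPoly c₂ = p₂)
    {x : Pairs 4 → ℝ} (hx : x ∈ Vcor {c₁, c₂})
    (hind : ∀ l₁ l₂ : ℝ, (∀ s, l₁ * eval x (pderiv s p₁) + l₂ * eval x (pderiv s p₂) = 0) →
      l₁ = 0 ∧ l₂ = 0) :
    algCone {c₁, c₂} x ⊆ tangentCone (Vcor {c₁, c₂}) x := by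
  have hr : ({c₁, c₂} : Set (CICouple 4)) = Set.range ![c₁, c₂] := by
    rw [Matrix.range_cons, Matrix.range_cons, Matrix.range_empty, Set.union_empty]
    rfl
  rw [hr] at hx ⊢
  refine algCone_subset_tangentCone_of_independent hx fun l hl => ?_
  obtain ⟨h₁, h₂⟩ := hind (l 0) (l 1) fun s => by
    simpa [Fin.sum_univ_two, e₁, e₂] using hl s
  ext i
  fin_cases i <;> assumption

lemma algCone_subset_tangentCone_of_independent_three {c₁ c₂ c₃ : CICouple 4}
    {p₁ p₂ p₃ : MvPolynomial (Pairs 4) ℝ} (e₁ : ciPoly c₁ = p₁) (e₂ : ciPoly c₂ = p₂)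
    (e₃ : ciPoly c₃ = p₃) {x : Pairs 4 → ℝ} (hx : x ∈ Vcor {c₁, c₂, c₃})
    (hind : ∀ l₁ l₂ l₃ : ℝ, (∀ s, l₁ * eval x (pderiv s p₁) + l₂ * eval x (pderiv s p₂) +
      l₃ * eval x (pderiv s p₃) = 0) → l₁ = 0 ∧ l₂ = 0 ∧ l₃ = 0) :
    algCone {c₁, c₂, c₃} x ⊆ tangentCone (Vcor {c₁, c₂, c₃}) x := by
  have hr : ({c₁, c₂, c₃} : Set (CICouple 4)) = Set.range ![c₁, c₂, c₃] := by
    rw [Matrix.range_cons, Matrix.range_cons, Matrix.range_cons, Matrix.range_empty,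
      Set.union_empty]
    rfl
  rw [hr] at hx ⊢
  refine algCone_subset_tangentCone_of_independent hx fun l hl => ?_
  obtain ⟨h₁, h₂, h₃⟩ := hind (l 0) (l 1) (l 2) fun s => by
    simpa [Fin.sum_univ_three, e₁, e₂, e₃] using hl s
  ext i
  fin_cases i <;> assumption

/-- A model whose algebraic cone at the identity is a tangent cone that is not closed under
addition is not smooth. -/
lemma not_isSmoothManifold {L : Set (CICouple 4)} (h0 : (0 : Pairs 4 → ℝ) ∈ Vcor L)
    (hTC : ∀ x ∈ Vcor L, tangentCone (Vcor L) x = algCone L x) {t u : Pairs 4 → ℝ}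
    (ht : t ∈ algCone L 0) (hu : u ∈ algCone L 0) (htu : t + u ∉ algCone L 0) :
    ¬ IsSmoothManifold (Vcor L) := by
  intro h
  rw [← hTC 0 h0] at ht hu htu
  exact htu (h.add_mem_tangentCone h0 ht hu)

lemma mem_algCone_iff {m : ℕ} {L : Set (CICouple m)} {x t : Pairs m → ℝ}
    {G : Set (MvPolynomial (Pairs m) ℝ)} (h : coneIdeal L x = Ideal.span G) :
    t ∈ algCone L x ↔ ∀ f ∈ G, eval t f = 0 := by
  have : t ∈ algCone L x ↔ Ideal.span G ≤ RingHom.ker (eval t) := by rw [← h]; rfl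
  rw [this, Ideal.span_le]
  rfl

end Coordinates

/-! ### Generators of the cone ideals -/

lemma coneIdeal_L14 : coneIdeal L14 0 =
    Ideal.span {X e14, X e23, X e12 * X e24 + X e13 * X e34} := by
  have m1 := ciPoly_14 ▸ ciPoly_mem (L := L14) (Or.inl rfl)
  have m2 := ciPoly_14_23 ▸ ciPoly_mem (L := L14) (Or.inr (Or.inl rfl))
  have m3 := ciPoly_23_14 ▸ ciPoly_mem (L := L14) (Or.inr (Or.inr rfl))
  refine coneIdeal_eq_span
    -- The couples 14 and 23|14 are solved for r14 and r23; the determinant of 14|23 becomes -g on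
    -- this surface.
    (r := fun k => entries (X e12) (X e13) 0 (X e12 * X e13 + X e24 * X e34) (X e24) (X e34))
    (g := X e12 * X e24 * (1 - X e13 * X e13 - X e34 * X e34) +
      X e13 * X e34 * (1 - X e12 * X e12 - X e24 * X e24))
    ((isHomogeneous_X_mul_X _ _).add (isHomogeneous_X_mul_X _ _))
    (ne_zero_of_eval (entries 1 0 0 0 1 0) (by simp)) (m1) (m3)
    -- A multiple of r14 cancels the linear part of 14|23, leaving q up to cubic terms.
    (sub_mem (Ideal.mul_mem_left _ (1 - X e23 * X e23) m1) m2) ?_ ?_ ?_ ?_ ?_ ?_ ?_ ?_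
  · simp
  · rw [translate_zero]
    convert add_mem (add_mem (add_mem (add_mem (mul_X_mul_X_mem (-1) e12 e13)
      (mul_X_mul_X_mem (-1) e24 e34))
      (mul_X_mul_X_mem (-X e23) e14 e14))
      (mul_X_mul_X_mem (X e34) e12 e14))
      (mul_X_mul_X_mem (X e13) e14 e24) using 1
    ring
  · rw [translate_zero]
    convert add_mem (mul_X_mul_X_mul_X_mem (-1) e12 e23 e34)
      (mul_X_mul_X_mul_X_mem (-1) e13 e23 e24) using 1
    ring
  · intro k
    simp
  · intro k
    simpa using add_mem (X_mul_X_mem e12 e13) (X_mul_X_mem e24 e34)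
  · intro k
    rw [forall_pairs]
    simp
  · convert add_mem (add_mem (add_mem (mul_X_mul_X_mul_X_mem (-X e13) e12 e24 e13)
      (mul_X_mul_X_mul_X_mem (-X e34) e12 e24 e34))
      (mul_X_mul_X_mul_X_mem (-X e12) e13 e34 e12))
      (mul_X_mul_X_mul_X_mem (-X e24) e13 e34 e24) using 1
    ring
  · rintro k c (rfl | rfl | rfl)
    · refine exists_sub_mul_mem (0) ?_ _
      rw [ciDet_14]
      simp only [entries_apply]
      ring
    · refine exists_sub_mul_mem (-1) ?_ _
      rw [ciDet_14_23]
      simp only [entries_apply]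
      ring
    · refine exists_sub_mul_mem (0) ?_ _
      rw [ciDet_23_14]
      simp only [entries_apply]
      ring

lemma coneIdeal_L46 : coneIdeal L46 0 =
    Ideal.span {X e14, X e23, X e12 * X e24 + X e13 * X e34} := by
  have m1 := ciPoly_14 ▸ ciPoly_mem (L := L46) (Or.inl rfl)
  have m2 := ciPoly_14_23 ▸ ciPoly_mem (L := L46) (Or.inr (Or.inl rfl))
  have m3 := ciPoly_23 ▸ ciPoly_mem (L := L46) (Or.inr (Or.inr rfl))
  refine coneIdeal_eq_span
    (r := fun k => entries (X e12) (X e13) 0 0 (X e24) (X e34))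
    (g := X e12 * X e24 + X e13 * X e34)
    ((isHomogeneous_X_mul_X _ _).add (isHomogeneous_X_mul_X _ _))
    (ne_zero_of_eval (entries 1 0 0 0 1 0) (by simp)) (m1) (m3)
    (add_mem (sub_mem (Ideal.mul_mem_left _ (1 - X e23 * X e23) m1) m2)
      (Ideal.mul_mem_left _ (X e12 * X e34 + X e13 * X e24) m3)) ?_ ?_ ?_ ?_ ?_ ?_ ?_ ?_
  · simp
  · simp
  · rw [translate_zero]
    convert zero_mem (idealOfVars (Pairs 4) ℝ ^ 3) using 1
    ring
  · intro k
    simp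
  · intro k
    simp
  · intro k
    rw [forall_pairs]
    simp
  · simp
  · rintro k c (rfl | rfl | rfl)
    · refine exists_sub_mul_mem (0) ?_ _
      rw [ciDet_14]
      simp only [entries_apply]
      ring
    · refine exists_sub_mul_mem (-1) ?_ _
      rw [ciDet_14_23]
      simp only [entries_apply]
      ring
    · refine exists_sub_mul_mem (0) ?_ _
      rw [ciDet_23]
      simp only [entries_apply]
      ring

lemma coneIdeal_L20 : coneIdeal L20 0 =
    Ideal.span {X e14, X e23, X e12 * X e24 - X e13 * X e34} := by
  have m1 := ciPoly_14_2 ▸ ciPoly_mem (L := L20) (Or.inl rfl)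
  have m2 := ciPoly_14_3 ▸ ciPoly_mem (L := L20) (Or.inr (Or.inl rfl))
  have m3 := ciPoly_23_14 ▸ ciPoly_mem (L := L20) (Or.inr (Or.inr rfl))
  refine coneIdeal_eq_span
    -- Solving 23|14 for r23 requires division by 1 - r14², with r14 = r12 r24. The inverse is
    -- replaced by its geometric series truncated after the k-th power.
    (r := fun k => entries (X e12) (X e13) (X e12 * X e24)
      ((X e12 * X e13 + X e24 * X e34 - X e12 * X e24 * (X e12 * X e34 + X e13 * X e24)) *
        ∑ i ∈ Finset.range (k + 1), (X e12 * X e24 * (X e12 * X e24)) ^ i) (X e24) (X e34))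
    (g := X e12 * X e24 - X e13 * X e34)
    ((isHomogeneous_X_mul_X _ _).sub (isHomogeneous_X_mul_X _ _))
    (ne_zero_of_eval (entries 1 0 0 0 1 0) (by simp)) (m1) (m3)
    (sub_mem m2 m1) ?_ ?_ ?_ ?_ ?_ ?_ ?_ ?_
  · rw [translate_zero]
    convert mul_X_mul_X_mem (-1) e12 e24 using 1
    ring
  · rw [translate_zero]
    convert add_mem (add_mem (add_mem (add_mem (mul_X_mul_X_mem (-1) e12 e13)
      (mul_X_mul_X_mem (-1) e24 e34))
      (mul_X_mul_X_mem (-X e23) e14 e14))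
      (mul_X_mul_X_mem (X e34) e12 e14))
      (mul_X_mul_X_mem (X e13) e14 e24) using 1
    ring
  · rw [translate_zero]
    convert zero_mem (idealOfVars (Pairs 4) ℝ ^ 3) using 1
    ring
  · intro k
    simpa using X_mul_X_mem e12 e24
  · intro k
    rw [entries_e23, Pi.zero_apply, map_zero, sub_zero]
    refine Ideal.mul_mem_right _ _ ?_
    convert add_mem (add_mem (mul_X_mul_X_mem (1) e12 e13)
      (mul_X_mul_X_mem (1) e24 e34))
      (mul_X_mul_X_mem (-(X e12 * X e34 + X e13 * X e24)) e12 e24) using 1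
    ring
  · intro k
    rw [forall_pairs]
    simp
  · simp
  · rintro k c (rfl | rfl | rfl)
    · refine exists_sub_mul_mem (0) ?_ _
      rw [ciDet_14_2]
      simp only [entries_apply]
      ring
    · refine exists_sub_mul_mem (1) ?_ _
      rw [ciDet_14_3]
      simp only [entries_apply]
      ring
    · refine ⟨0, ?_⟩
      -- The truncation error is a multiple of the (k + 1)-st power of r14²; for order k + 1 it is
      -- enough that r14² has order at least one.
      have hy : (X e12 * X e24 * (X e12 * X e24) : MvPolynomial (Pairs 4) ℝ) ∈
          idealOfVars (Pairs 4) ℝ := Ideal.mul_mem_left _ _ (Ideal.mul_mem_left _ _ (X_mem_pow_one _))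
      have hgeom := geom_sum_mul_neg (X e12 * X e24 * (X e12 * X e24) : MvPolynomial (Pairs 4) ℝ)
        (k + 1)
      convert Ideal.mul_mem_left _ (-(X e12 * X e13 + X e24 * X e34 -
        X e12 * X e24 * (X e12 * X e34 + X e13 * X e24))) (Ideal.pow_mem_pow hy (k + 1)) using 1
      rw [ciDet_23_14]
      simp only [entries_apply]
      linear_combination (X e12 * X e13 + X e24 * X e34 -
        X e12 * X e24 * (X e12 * X e34 + X e13 * X e24)) * hgeom

lemma coneIdeal_L51 : coneIdeal L51 0 =
    Ideal.span {X e14, X e23, X e12 * X e24 - X e13 * X e34} := by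
  have m1 := ciPoly_14_2 ▸ ciPoly_mem (L := L51) (Or.inl rfl)
  have m2 := ciPoly_14_3 ▸ ciPoly_mem (L := L51) (Or.inr (Or.inl rfl))
  have m3 := ciPoly_23 ▸ ciPoly_mem (L := L51) (Or.inr (Or.inr rfl))
  refine coneIdeal_eq_span
    (r := fun k => entries (X e12) (X e13) (X e12 * X e24) 0 (X e24) (X e34))
    (g := X e12 * X e24 - X e13 * X e34)
    ((isHomogeneous_X_mul_X _ _).sub (isHomogeneous_X_mul_X _ _))
    (ne_zero_of_eval (entries 1 0 0 0 1 0) (by simp)) (m1) (m3)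
    (sub_mem m2 m1) ?_ ?_ ?_ ?_ ?_ ?_ ?_ ?_
  · rw [translate_zero]
    convert mul_X_mul_X_mem (-1) e12 e24 using 1
    ring
  · simp
  · rw [translate_zero]
    convert zero_mem (idealOfVars (Pairs 4) ℝ ^ 3) using 1
    ring
  · intro k
    simpa using X_mul_X_mem e12 e24
  · intro k
    simp
  · intro k
    rw [forall_pairs]
    simp
  · simp
  · rintro k c (rfl | rfl | rfl)
    · refine exists_sub_mul_mem (0) ?_ _
      rw [ciDet_14_2]
      simp only [entries_apply]
      ring
    · refine exists_sub_mul_mem (1) ?_ _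
      rw [ciDet_14_3]
      simp only [entries_apply]
      ring
    · refine exists_sub_mul_mem (0) ?_ _
      rw [ciDet_23]
      simp only [entries_apply]
      ring

lemma coneIdeal_L30 : coneIdeal L30 0 =
    Ideal.span {X e14, X e23, X e12 * X e13 + X e24 * X e34} := by
  have m1 := ciPoly_14_2 ▸ ciPoly_mem (L := L30) (Or.inl rfl)
  have m2 := ciPoly_23 ▸ ciPoly_mem (L := L30) (Or.inr (Or.inl rfl))
  have m3 := ciPoly_23_14 ▸ ciPoly_mem (L := L30) (Or.inr (Or.inr rfl))
  refine coneIdeal_eq_span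
    (r := fun k => entries (X e12) (X e13) (X e12 * X e24) 0 (X e24) (X e34))
    -- Minus the determinant of 23|14 at r14 = r12 r24, r23 = 0.
    (g := X e12 * X e13 + X e24 * X e34 - X e12 * X e24 * (X e12 * X e34 + X e13 * X e24))
    ((isHomogeneous_X_mul_X _ _).add (isHomogeneous_X_mul_X _ _))
    (ne_zero_of_eval (entries 1 1 0 0 0 0) (by simp)) (m1) (m2)
    (sub_mem (Ideal.mul_mem_left _ (1 - X e14 * X e14) m2) m3) ?_ ?_ ?_ ?_ ?_ ?_ ?_ ?_
  · rw [translate_zero]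
    convert mul_X_mul_X_mem (-1) e12 e24 using 1
    ring
  · simp
  · rw [translate_zero]
    convert add_mem (mul_X_mul_X_mul_X_mem (-1) e12 e14 e34)
      (mul_X_mul_X_mul_X_mem (-1) e13 e14 e24) using 1
    ring
  · intro k
    simpa using X_mul_X_mem e12 e24
  · intro k
    simp
  · intro k
    rw [forall_pairs]
    simp
  · convert add_mem (mul_X_mul_X_mul_X_mem (-X e12) e12 e24 e34)
      (mul_X_mul_X_mul_X_mem (-X e24) e12 e24 e13) using 1
    ring
  · rintro k c (rfl | rfl | rfl)
    · refine exists_sub_mul_mem (0) ?_ _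
      rw [ciDet_14_2]
      simp only [entries_apply]
      ring
    · refine exists_sub_mul_mem (0) ?_ _
      rw [ciDet_23]
      simp only [entries_apply]
      ring
    · refine exists_sub_mul_mem (-1) ?_ _
      rw [ciDet_23_14]
      simp only [entries_apply]
      ring

lemma coneIdeal_L36 : coneIdeal L36 0 =
    Ideal.span {X e12, X e34, X e13 * X e23 - X e14 * X e24} := by
  have m1 := ciPoly_12_3 ▸ ciPoly_mem (L := L36) (Or.inl rfl)
  have m2 := ciPoly_12_4 ▸ ciPoly_mem (L := L36) (Or.inr (Or.inl rfl))
  have m3 := ciPoly_34_1 ▸ ciPoly_mem (L := L36) (Or.inr (Or.inr rfl))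
  refine coneIdeal_eq_span
    (r := fun k => entries (X e13 * X e23) (X e13) (X e14) (X e23) (X e24) (X e13 * X e14))
    (g := X e13 * X e23 - X e14 * X e24)
    ((isHomogeneous_X_mul_X _ _).sub (isHomogeneous_X_mul_X _ _))
    (ne_zero_of_eval (entries 0 1 0 1 0 0) (by simp)) (m1) (m3)
    (sub_mem m2 m1) ?_ ?_ ?_ ?_ ?_ ?_ ?_ ?_
  · rw [translate_zero]
    convert mul_X_mul_X_mem (-1) e13 e23 using 1
    ring
  · rw [translate_zero]
    convert mul_X_mul_X_mem (-1) e13 e14 using 1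
    ring
  · rw [translate_zero]
    convert zero_mem (idealOfVars (Pairs 4) ℝ ^ 3) using 1
    ring
  · intro k
    simpa using X_mul_X_mem e13 e23
  · intro k
    simpa using X_mul_X_mem e13 e14
  · intro k
    rw [forall_pairs]
    simp
  · simp
  · rintro k c (rfl | rfl | rfl)
    · refine exists_sub_mul_mem (0) ?_ _
      rw [ciDet_12_3]
      simp only [entries_apply]
      ring
    · refine exists_sub_mul_mem (1) ?_ _
      rw [ciDet_12_4]
      simp only [entries_apply]
      ring
    · refine exists_sub_mul_mem (0) ?_ _
      rw [ciDet_34_1]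
      simp only [entries_apply]
      ring

lemma coneIdeal_L29 (ρ : ℝ) : coneIdeal L29 (Pi.single e14 ρ) =
    Ideal.span {X e23, X e13 * (X e12 - C ρ * X e24) + X e34 * (X e24 - C ρ * X e12)} := by
  have m1 := ciPoly_23 ▸ ciPoly_mem (L := L29) (Or.inl rfl)
  have m2 := ciPoly_23_14 ▸ ciPoly_mem (L := L29) (Or.inr rfl)
  -- Only one variable is eliminated here, so it fills both slots of `coneIdeal_eq_span`.
  rw [single_e14, ← Set.insert_idem]
  refine coneIdeal_eq_span
    (r := fun k => entries (X e12) (X e13) (C ρ + X e14) 0 (X e24) (X e34))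
    (g := X e12 * X e13 + X e24 * X e34 - (C ρ + X e14) * (X e12 * X e34 + X e13 * X e24))
    (((isHomogeneous_X ℝ _).mul ((isHomogeneous_X ℝ _).sub (isHomogeneous_C_mul_X ρ _))).add
      ((isHomogeneous_X ℝ _).mul ((isHomogeneous_X ℝ _).sub (isHomogeneous_C_mul_X ρ _))))
    (ne_zero_of_eval (entries 1 1 0 0 0 0) (by simp)) (m1) (m1)
    (sub_mem (Ideal.mul_mem_left _ (1 - X e14 * X e14) m1) m2) ?_ ?_ ?_ ?_ ?_ ?_ ?_ ?_
  · simp [translate_X]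
  · simp [translate_X]
  · simp only [map_sub, map_mul, map_add, map_one, translate_X, entries_apply, map_zero, zero_add]
    convert add_mem (mul_X_mul_X_mul_X_mem (-1) e12 e14 e34)
      (mul_X_mul_X_mul_X_mem (-1) e13 e14 e24) using 1
    ring
  · intro k
    simp
  · intro k
    simp
  · intro k
    rw [forall_pairs]
    simp
  · convert add_mem (mul_X_mul_X_mul_X_mem (-1) e12 e14 e34)
      (mul_X_mul_X_mul_X_mem (-1) e13 e14 e24) using 1
    ring
  · rintro k c (rfl | rfl)
    · refine exists_sub_mul_mem (0) ?_ _
      rw [ciDet_23]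
      simp only [entries_apply]
      ring
    · refine exists_sub_mul_mem (-1) ?_ _
      rw [ciDet_23_14]
      simp only [entries_apply]
      ring

lemma coneIdeal_L32 (ρ : ℝ) : coneIdeal L32 (Pi.single e34 ρ) =
    Ideal.span {X e12, X e13 * X e23 - X e14 * X e24} := by
  have m1 := ciPoly_12_3 ▸ ciPoly_mem (L := L32) (Or.inl rfl)
  have m2 := ciPoly_12_4 ▸ ciPoly_mem (L := L32) (Or.inr rfl)
  rw [single_e34, ← Set.insert_idem]
  refine coneIdeal_eq_span
    (r := fun k => entries (X e13 * X e23) (X e13) (X e14) (X e23) (X e24) (C ρ + X e34))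
    (g := X e13 * X e23 - X e14 * X e24)
    ((isHomogeneous_X_mul_X _ _).sub (isHomogeneous_X_mul_X _ _))
    (ne_zero_of_eval (entries 0 1 0 1 0 0) (by simp)) (m1) (m1)
    (sub_mem m2 m1) ?_ ?_ ?_ ?_ ?_ ?_ ?_ ?_
  · simp only [map_sub, map_mul, translate_X, entries_apply, map_zero, zero_add]
    convert mul_X_mul_X_mem (-1) e13 e23 using 1
    ring
  · simp only [map_sub, map_mul, translate_X, entries_apply, map_zero, zero_add]
    convert mul_X_mul_X_mem (-1) e13 e23 using 1
    ring
  · simp only [map_sub, map_mul, translate_X, entries_apply, map_zero, zero_add]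
    convert zero_mem (idealOfVars (Pairs 4) ℝ ^ 3) using 1
    ring
  · intro k
    simpa using X_mul_X_mem e13 e23
  · intro k
    simpa using X_mul_X_mem e13 e23
  · intro k
    rw [forall_pairs]
    simp
  · simp
  · rintro k c (rfl | rfl)
    · refine exists_sub_mul_mem (0) ?_ _
      rw [ciDet_12_3]
      simp only [entries_apply]
      ring
    · refine exists_sub_mul_mem (1) ?_ _
      rw [ciDet_12_4]
      simp only [entries_apply]
      ring

/-! ### Tangent cones of the eight models -/

/-- With a, b, e, f for r12, r13, r24, r34, the left side of h is the determinant of 14|23 on the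
surface r14 = 0, r23 = ab + ef, and h1 to h4 are its partial derivatives; the origin is the only
singular zero in the given region. Euler-type combinations of the derivatives give a(ab + ef)f =
b(ab + ef)e = 0, hence ae + bf = 0, and the bound on b then forces ae = bf = 0. The derivatives
finally reduce to each variable times a positive minor. -/
lemma eq_zero_of_critical {a b e f : ℝ} (n1 : 0 < 1 - b ^ 2 - f ^ 2) (n2 : 0 < 1 - a ^ 2 - e ^ 2)
    (h : -(a * e) - b * f + (a * b + e * f) * (a * f + b * e) = 0)
    (h1 : -e + f * (a * b + e * f) + b * (a * f + b * e) = 0)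
    (h2 : -f + e * (a * b + e * f) + a * (a * f + b * e) = 0)
    (h3 : -a + b * (a * b + e * f) + f * (a * f + b * e) = 0)
    (h4 : -b + a * (a * b + e * f) + e * (a * f + b * e) = 0) :
    a = 0 ∧ b = 0 ∧ e = 0 ∧ f = 0 := by
  have k1 : a * (a * b + e * f) * f = 0 := by linear_combination (a * h1 + f * h4 - h) / 2
  have k2 : b * (a * b + e * f) * e = 0 := by linear_combination (b * h2 + e * h3 - h) / 2
  have k3 : a * e + b * f = 0 := by linear_combination k1 + k2 - h
  have k4 : a * e * (1 + a ^ 2 - b ^ 2) = 0 := by linear_combination -a * h1 + k1 + a ^ 2 * k3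
  have k5 : a * e = 0 :=
    (mul_eq_zero.1 k4).resolve_right (by nlinarith [sq_nonneg f, sq_nonneg a])
  have k6 : b * f = 0 := by linear_combination k3 - k5
  refine ⟨mul_right_cancel₀ n1.ne' ?_, mul_right_cancel₀ n2.ne' ?_, mul_right_cancel₀ n1.ne' ?_,
    mul_right_cancel₀ n2.ne' ?_⟩
  · linear_combination -h3 + 2 * e * k6
  · linear_combination -h4 + 2 * f * k5
  · linear_combination -h1 + 2 * a * k6
  · linear_combination -h2 + 2 * b * k5

theorem tangentCone_L14 {x : Pairs 4 → ℝ} (hx : x ∈ Vcor L14) :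
    tangentCone (Vcor L14) x = algCone L14 x := by
  refine (tangentCone_subset_algCone hx).antisymm ?_
  have hpd := hx.1
  have hx' := hx.2
  simp only [L14, Set.mem_insert_iff, Set.mem_singleton_iff, forall_eq_or_imp, forall_eq,
    ciDet_14, ciDet_14_23, ciDet_23_14] at hx'
  obtain ⟨h1, h2, h3⟩ := hx'
  by_cases hs : x e12 = 0 ∧ x e13 = 0 ∧ x e24 = 0 ∧ x e34 = 0
  · obtain ⟨s1, s2, s3, s4⟩ := hs
    obtain rfl : x = 0 := by
      refine funext (forall_pairs.2 ?_)
      simp_all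
    intro t ht
    rw [mem_algCone_iff coneIdeal_L14] at ht
    simp only [Set.mem_insert_iff, Set.mem_singleton_iff, forall_eq_or_imp, forall_eq, map_add,
      map_mul, eval_X] at ht
    obtain ⟨t1, t2, tq⟩ := ht
    -- Scaling r12 and r24 by l corrects the straight line: given the quadratic relation on t, the
    -- determinant of 14|23 vanishes along the curve as soon as l²(1 - τ²k) = 1. Since l(0) = 1, the
    -- velocity is still t.
    set k := t e13 ^ 2 + t e34 ^ 2 - t e12 ^ 2 - t e24 ^ 2 with hk
    have hcont : ContinuousAt (fun τ : ℝ => 1 - τ ^ 2 * k) 0 := by fun_prop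
    have hev := hcont.eventually (lt_mem_nhds (a := 0) (by simp))
    set l : ℝ → ℝ := fun τ => (√(1 - τ ^ 2 * k))⁻¹ with hl
    have hl0 : l 0 = 1 := by simp [hl]
    have hlc : ContinuousAt l 0 := hcont.sqrt.inv₀ (by simp)
    refine mem_tangentCone_Vcor hx
      (y := fun τ => entries (τ * (l τ * t e12)) (τ * t e13) 0
        (τ * (τ * l τ * (t e12 * t e13 + t e24 * t e34))) (τ * (l τ * t e24)) (τ * t e34))
      (hasDerivAt_entries
        (hasDerivAt_mul_of_continuousAt (by fun_prop) (by simp [hl0]))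
        (hasDerivAt_mul_of_continuousAt (continuousAt_const) rfl)
        (hasDerivAt_zero_of_eq t1)
        (hasDerivAt_mul_of_continuousAt (by fun_prop) (by simp [t2]))
        (hasDerivAt_mul_of_continuousAt (by fun_prop) (by simp [hl0]))
        (hasDerivAt_mul_of_continuousAt (continuousAt_const) rfl))
      ?_ ?_
    · exact entries_ext (by simp) (by simp) (by simp) (by simp) (by simp) (by simp)
    · filter_upwards [hev] with τ hτ
      have hlτ : l τ ^ 2 * (1 - τ ^ 2 * k) = 1 := by
        rw [hl]
        simp only [inv_pow, Real.sq_sqrt hτ.le]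
        exact inv_mul_cancel₀ hτ.ne'
      rw [hk] at hlτ
      rintro c (rfl | rfl | rfl)
      · rw [ciDet_14]
        simp only [entries_apply]
      · rw [ciDet_14_23]
        simp only [entries_apply]
        linear_combination (-τ ^ 2 * t e12 * t e24) * hlτ +
          (-τ ^ 2 + τ ^ 4 * l τ ^ 2 * (t e12 ^ 2 + t e24 ^ 2)) * tq
      · rw [ciDet_23_14]
        simp only [entries_apply]
        ring
  · refine algCone_subset_tangentCone_of_independent_three ciPoly_14 ciPoly_14_23 ciPoly_23_14 hx
      fun u v w h => ?_
    obtain ⟨a1, a2, a3, a4, a5, a6⟩ := forall_pairs.1 h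
    simp [pderiv_X, -mul_eq_zero] at a1 a2 a3 a4 a5 a6
    simp only [h1, mul_zero, zero_mul, add_zero, zero_add, sub_zero, mul_one] at h2 h3 a1 a2 a3 a4 a5 a6
    have n1 : 0 < 1 - x e13 ^ 2 - x e34 ^ 2 :=
      minor_pos_of_posDef (i := 0) (j := 3) (k := 2) hpd (by decide) (by decide) (by decide) h1
    have n2 : 0 < 1 - x e12 ^ 2 - x e24 ^ 2 :=
      minor_pos_of_posDef (i := 0) (j := 3) (k := 1) hpd (by decide) (by decide) (by decide) h1
    have hd : x e23 = x e12 * x e13 + x e24 * x e34 := by linear_combination h3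
    -- The r23-coordinate of the relation eliminates w. What remains is v times the gradient of the
    -- determinant of 14|23 restricted to the surface where 14 and 23|14 hold, so
    -- `eq_zero_of_critical` applies if v ≠ 0.
    have hw : w = -v * (x e12 * x e34 + x e13 * x e24) := by linear_combination a4
    have hv : v = 0 := by
      by_contra hv
      rw [hw, hd] at a1 a2 a5 a6
      rw [hd] at h2
      exact hs (eq_zero_of_critical n1 n2 (by linear_combination h2)
        (mul_left_cancel₀ hv (by linear_combination a1))
        (mul_left_cancel₀ hv (by linear_combination a2))
        (mul_left_cancel₀ hv (by linear_combination a5))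
        (mul_left_cancel₀ hv (by linear_combination a6)))
    simp_all

theorem tangentCone_L46 {x : Pairs 4 → ℝ} (hx : x ∈ Vcor L46) :
    tangentCone (Vcor L46) x = algCone L46 x := by
  refine (tangentCone_subset_algCone hx).antisymm ?_
  have hpd := hx.1
  have hx' := hx.2
  simp only [L46, Set.mem_insert_iff, Set.mem_singleton_iff, forall_eq_or_imp, forall_eq,
    ciDet_14, ciDet_14_23, ciDet_23] at hx'
  obtain ⟨h1, h2, h3⟩ := hx'
  by_cases hs : x e12 = 0 ∧ x e13 = 0 ∧ x e24 = 0 ∧ x e34 = 0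
  · obtain ⟨s1, s2, s3, s4⟩ := hs
    obtain rfl : x = 0 := by
      refine funext (forall_pairs.2 ?_)
      simp_all
    intro t ht
    rw [mem_algCone_iff coneIdeal_L46] at ht
    simp only [Set.mem_insert_iff, Set.mem_singleton_iff, forall_eq_or_imp, forall_eq, map_add,
      map_mul, eval_X] at ht
    obtain ⟨t1, t2, tq⟩ := ht
    refine mem_tangentCone_Vcor hx
      (y := fun τ => entries (τ * t e12) (τ * t e13) 0 0 (τ * t e24) (τ * t e34))
      (hasDerivAt_entries
        (hasDerivAt_mul_of_continuousAt (continuousAt_const) rfl)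
        (hasDerivAt_mul_of_continuousAt (continuousAt_const) rfl)
        (hasDerivAt_zero_of_eq t1)
        (hasDerivAt_zero_of_eq t2)
        (hasDerivAt_mul_of_continuousAt (continuousAt_const) rfl)
        (hasDerivAt_mul_of_continuousAt (continuousAt_const) rfl))
      ?_ ?_
    · exact entries_ext (by simp) (by simp) (by simp) (by simp) (by simp) (by simp)
    · filter_upwards with τ
      rintro c (rfl | rfl | rfl)
      · rw [ciDet_14]
        simp only [entries_apply]
      · rw [ciDet_14_23]
        simp only [entries_apply]
        linear_combination -τ ^ 2 * tq
      · rw [ciDet_23]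
        simp only [entries_apply]
  · refine algCone_subset_tangentCone_of_independent_three ciPoly_14 ciPoly_14_23 ciPoly_23 hx
      fun u v w h => ?_
    obtain ⟨a1, a2, a3, a4, a5, a6⟩ := forall_pairs.1 h
    simp [pderiv_X, -mul_eq_zero] at a1 a2 a3 a4 a5 a6
    simp only [h1, h3, mul_zero, zero_mul, add_zero, zero_add, sub_zero, mul_one] at a1 a2 a3 a4 a5 a6
    have hv : v = 0 := by
      by_contra hv
      exact hs ⟨by simpa [hv] using a5, by simpa [hv] using a6, by simpa [hv] using a1,
        by simpa [hv] using a2⟩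
    simp_all

theorem tangentCone_L20 {x : Pairs 4 → ℝ} (hx : x ∈ Vcor L20) :
    tangentCone (Vcor L20) x = algCone L20 x := by
  refine (tangentCone_subset_algCone hx).antisymm ?_
  have hpd := hx.1
  have hx' := hx.2
  simp only [L20, Set.mem_insert_iff, Set.mem_singleton_iff, forall_eq_or_imp, forall_eq,
    ciDet_14_2, ciDet_14_3, ciDet_23_14] at hx'
  obtain ⟨h1, h2, h3⟩ := hx'
  by_cases hs : x e12 = 0 ∧ x e13 = 0 ∧ x e24 = 0 ∧ x e34 = 0
  · obtain ⟨s1, s2, s3, s4⟩ := hs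
    obtain rfl : x = 0 := by
      refine funext (forall_pairs.2 ?_)
      simp_all
    intro t ht
    rw [mem_algCone_iff coneIdeal_L20] at ht
    simp only [Set.mem_insert_iff, Set.mem_singleton_iff, forall_eq_or_imp, forall_eq, map_sub,
      map_mul, eval_X] at ht
    obtain ⟨t1, t2, tq⟩ := ht
    have hcont : ContinuousAt (fun τ : ℝ => 1 - τ ^ 4 * t e12 ^ 2 * t e24 ^ 2) 0 := by fun_prop
    have hne : 1 - (0 : ℝ) ^ 4 * t e12 ^ 2 * t e24 ^ 2 ≠ 0 := by simp
    have hev := hcont.eventually_ne hne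
    refine mem_tangentCone_Vcor hx
      -- The line in the four free entries is lifted by solving 14|2 for r14 and 23|14 for r23; the
      -- remaining couple 14|3 is τ² times the quadratic relation on t.
      (y := fun τ => entries (τ * t e12) (τ * t e13) (τ * (τ * (t e12 * t e24)))
        (τ * (τ * (t e12 * t e13 + t e24 * t e34 -
          τ ^ 2 * (t e12 * t e24) * (t e12 * t e34 + t e13 * t e24)) /
          (1 - τ ^ 4 * t e12 ^ 2 * t e24 ^ 2)))
        (τ * t e24) (τ * t e34))
      (hasDerivAt_entries
        (hasDerivAt_mul_of_continuousAt (continuousAt_const) rfl)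
        (hasDerivAt_mul_of_continuousAt (continuousAt_const) rfl)
        (hasDerivAt_mul_of_continuousAt (by fun_prop) (by simp [t1]))
        (hasDerivAt_mul_of_continuousAt (ContinuousAt.div (by fun_prop) hcont hne)
          (by simp [t2]))
        (hasDerivAt_mul_of_continuousAt (continuousAt_const) rfl)
        (hasDerivAt_mul_of_continuousAt (continuousAt_const) rfl))
      ?_ ?_
    · exact entries_ext (by simp) (by simp) (by simp) (by simp) (by simp) (by simp)
    · filter_upwards [hev] with τ hτ
      rintro c (rfl | rfl | rfl)
      · rw [ciDet_14_2]
        simp only [entries_apply]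
        ring
      · rw [ciDet_14_3]
        simp only [entries_apply]
        linear_combination τ ^ 2 * tq
      · rw [ciDet_23_14]
        simp only [entries_apply]
        field_simp
        ring
  · refine algCone_subset_tangentCone_of_independent_three ciPoly_14_2 ciPoly_14_3 ciPoly_23_14 hx
      fun u v w h => ?_
    obtain ⟨a1, a2, a3, a4, a5, a6⟩ := forall_pairs.1 h
    simp [pderiv_X, -mul_eq_zero] at a1 a2 a3 a4 a5 a6
    have hc := sq_lt_one_of_posDef hpd e14
    have hne : 1 - x e14 * x e14 ≠ 0 := by nlinarith
    -- The entry r23 occurs only in the determinant of 23|14, with coefficient 1 - r14² ≠ 0.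
    have hw : w = 0 := by
      have : w * (1 - x e14 * x e14) = 0 := by linear_combination a4
      exact (mul_eq_zero.1 this).resolve_right hne
    subst hw
    have hv : v = 0 := by
      by_contra hv
      have hu : u = -v := by linear_combination a3
      exact hs ⟨by simpa [hu, hv] using a5, by simpa [hv] using a6, by simpa [hu, hv] using a1,
        by simpa [hv] using a2⟩
    simp_all

theorem tangentCone_L51 {x : Pairs 4 → ℝ} (hx : x ∈ Vcor L51) :
    tangentCone (Vcor L51) x = algCone L51 x := by
  refine (tangentCone_subset_algCone hx).antisymm ?_
  have hpd := hx.1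
  have hx' := hx.2
  simp only [L51, Set.mem_insert_iff, Set.mem_singleton_iff, forall_eq_or_imp, forall_eq,
    ciDet_14_2, ciDet_14_3, ciDet_23] at hx'
  obtain ⟨h1, h2, h3⟩ := hx'
  by_cases hs : x e12 = 0 ∧ x e13 = 0 ∧ x e24 = 0 ∧ x e34 = 0
  · obtain ⟨s1, s2, s3, s4⟩ := hs
    obtain rfl : x = 0 := by
      refine funext (forall_pairs.2 ?_)
      simp_all
    intro t ht
    rw [mem_algCone_iff coneIdeal_L51] at ht
    simp only [Set.mem_insert_iff, Set.mem_singleton_iff, forall_eq_or_imp, forall_eq, map_sub,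
      map_mul, eval_X] at ht
    obtain ⟨t1, t2, tq⟩ := ht
    refine mem_tangentCone_Vcor hx
      (y := fun τ => entries (τ * t e12) (τ * t e13) (τ * (τ * (t e12 * t e24))) 0 (τ * t e24) (τ * t e34))
      (hasDerivAt_entries
        (hasDerivAt_mul_of_continuousAt (continuousAt_const) rfl)
        (hasDerivAt_mul_of_continuousAt (continuousAt_const) rfl)
        (hasDerivAt_mul_of_continuousAt (by fun_prop) (by simp [t1]))
        (hasDerivAt_zero_of_eq t2)
        (hasDerivAt_mul_of_continuousAt (continuousAt_const) rfl)
        (hasDerivAt_mul_of_continuousAt (continuousAt_const) rfl))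
      ?_ ?_
    · exact entries_ext (by simp) (by simp) (by simp) (by simp) (by simp) (by simp)
    · filter_upwards with τ
      rintro c (rfl | rfl | rfl)
      · rw [ciDet_14_2]
        simp only [entries_apply]
        ring
      · rw [ciDet_14_3]
        simp only [entries_apply]
        linear_combination τ ^ 2 * tq
      · rw [ciDet_23]
        simp only [entries_apply]
  · refine algCone_subset_tangentCone_of_independent_three ciPoly_14_2 ciPoly_14_3 ciPoly_23 hx
      fun u v w h => ?_
    obtain ⟨a1, a2, a3, a4, a5, a6⟩ := forall_pairs.1 h
    simp [pderiv_X, -mul_eq_zero] at a1 a2 a3 a4 a5 a6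
    have hv : v = 0 := by
      by_contra hv
      have hu : u = -v := by linear_combination a3
      exact hs ⟨by simpa [hu, hv] using a5, by simpa [hv] using a6, by simpa [hu, hv] using a1,
        by simpa [hv] using a2⟩
    simp_all

theorem tangentCone_L30 {x : Pairs 4 → ℝ} (hx : x ∈ Vcor L30) :
    tangentCone (Vcor L30) x = algCone L30 x := by
  refine (tangentCone_subset_algCone hx).antisymm ?_
  have hpd := hx.1
  have hx' := hx.2
  simp only [L30, Set.mem_insert_iff, Set.mem_singleton_iff, forall_eq_or_imp, forall_eq,
    ciDet_14_2, ciDet_23, ciDet_23_14] at hx'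
  obtain ⟨h1, h2, h3⟩ := hx'
  by_cases hs : x e12 = 0 ∧ x e13 = 0 ∧ x e24 = 0 ∧ x e34 = 0
  · obtain ⟨s1, s2, s3, s4⟩ := hs
    obtain rfl : x = 0 := by
      refine funext (forall_pairs.2 ?_)
      simp_all
    intro t ht
    rw [mem_algCone_iff coneIdeal_L30] at ht
    simp only [Set.mem_insert_iff, Set.mem_singleton_iff, forall_eq_or_imp, forall_eq, map_add,
      map_mul, eval_X] at ht
    obtain ⟨t1, t2, tq⟩ := ht
    have hcont : ContinuousAt (fun τ : ℝ => 1 - τ ^ 2 * t e24 ^ 2) 0 := by fun_prop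
    have hne : 1 - (0 : ℝ) ^ 2 * t e24 ^ 2 ≠ 0 := by simp
    have hev := hcont.eventually_ne hne
    refine mem_tangentCone_Vcor hx
      -- For r14 = r12 r24 and r23 = 0, the couple 23|14 reads r12 r13 (1 - r24²) + r24 r34 (1 -
      -- r12²) = 0; the quotient multiplying r13 reduces this to the quadratic relation on t.
      (y := fun τ => entries (τ * t e12)
        (τ * (t e13 * (1 - τ ^ 2 * t e12 ^ 2) / (1 - τ ^ 2 * t e24 ^ 2)))
        (τ * (τ * (t e12 * t e24))) 0 (τ * t e24) (τ * t e34))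
      (hasDerivAt_entries
        (hasDerivAt_mul_of_continuousAt (continuousAt_const) rfl)
        (hasDerivAt_mul_of_continuousAt (ContinuousAt.div (by fun_prop) hcont hne) (by simp))
        (hasDerivAt_mul_of_continuousAt (by fun_prop) (by simp [t1]))
        (hasDerivAt_zero_of_eq t2)
        (hasDerivAt_mul_of_continuousAt (continuousAt_const) rfl)
        (hasDerivAt_mul_of_continuousAt (continuousAt_const) rfl))
      ?_ ?_
    · exact entries_ext (by simp) (by simp) (by simp) (by simp) (by simp) (by simp)
    · filter_upwards [hev] with τ hτ
      rintro c (rfl | rfl | rfl)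
      · rw [ciDet_14_2]
        simp only [entries_apply]
        ring
      · rw [ciDet_23]
        simp only [entries_apply]
      · rw [ciDet_23_14]
        simp only [entries_apply]
        field_simp
        linear_combination -τ ^ 2 * (1 - τ ^ 2 * t e12 ^ 2) * (1 - τ ^ 2 * t e24 ^ 2) * tq
  · refine algCone_subset_tangentCone_of_independent_three ciPoly_14_2 ciPoly_23 ciPoly_23_14 hx
      fun u v w h => ?_
    obtain ⟨a1, a2, a3, a4, a5, a6⟩ := forall_pairs.1 h
    simp [pderiv_X, -mul_eq_zero] at a1 a2 a3 a4 a5 a6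
    have hc := sq_lt_one_of_posDef hpd e14
    have hw : w = 0 := by
      by_contra hw
      have b2 : x e12 = x e14 * x e24 := by
        refine mul_left_cancel₀ hw ?_
        linear_combination -a2
      have b6 : x e24 = x e14 * x e12 := by
        refine mul_left_cancel₀ hw ?_
        linear_combination -a6
      have hne : 1 - x e14 ^ 2 ≠ 0 := (sub_pos.2 hc).ne'
      have c1 : x e12 = 0 := mul_left_cancel₀ hne (by linear_combination b2 + x e14 * b6)
      have c2 : x e24 = 0 := mul_left_cancel₀ hne (by linear_combination b6 + x e14 * b2)
      have c3 : x e14 = 0 := by simpa [c1] using h1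
      exact hs ⟨c1, by simpa [c2, c3, hw] using a1, c2, by simpa [c1, c3, hw] using a5⟩
    simp_all

theorem tangentCone_L36 {x : Pairs 4 → ℝ} (hx : x ∈ Vcor L36) :
    tangentCone (Vcor L36) x = algCone L36 x := by
  refine (tangentCone_subset_algCone hx).antisymm ?_
  have hpd := hx.1
  have hx' := hx.2
  simp only [L36, Set.mem_insert_iff, Set.mem_singleton_iff, forall_eq_or_imp, forall_eq,
    ciDet_12_3, ciDet_12_4, ciDet_34_1] at hx'
  obtain ⟨h1, h2, h3⟩ := hx'
  by_cases hs : x e13 = 0 ∧ x e14 = 0 ∧ x e23 = 0 ∧ x e24 = 0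
  · obtain ⟨s1, s2, s3, s4⟩ := hs
    obtain rfl : x = 0 := by
      refine funext (forall_pairs.2 ?_)
      simp_all
    intro t ht
    rw [mem_algCone_iff coneIdeal_L36] at ht
    simp only [Set.mem_insert_iff, Set.mem_singleton_iff, forall_eq_or_imp, forall_eq, map_sub,
      map_mul, eval_X] at ht
    obtain ⟨t1, t2, tq⟩ := ht
    refine mem_tangentCone_Vcor hx
      (y := fun τ => entries (τ * (τ * (t e13 * t e23))) (τ * t e13) (τ * t e14) (τ * t e23) (τ * t e24)
        (τ * (τ * (t e13 * t e14))))
      (hasDerivAt_entries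
        (hasDerivAt_mul_of_continuousAt (by fun_prop) (by simp [t1]))
        (hasDerivAt_mul_of_continuousAt (continuousAt_const) rfl)
        (hasDerivAt_mul_of_continuousAt (continuousAt_const) rfl)
        (hasDerivAt_mul_of_continuousAt (continuousAt_const) rfl)
        (hasDerivAt_mul_of_continuousAt (continuousAt_const) rfl)
        (hasDerivAt_mul_of_continuousAt (by fun_prop) (by simp [t2])))
      ?_ ?_
    · exact entries_ext (by simp) (by simp) (by simp) (by simp) (by simp) (by simp)
    · filter_upwards with τ
      rintro c (rfl | rfl | rfl)
      · rw [ciDet_12_3]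
        simp only [entries_apply]
        ring
      · rw [ciDet_12_4]
        simp only [entries_apply]
        linear_combination τ ^ 2 * tq
      · rw [ciDet_34_1]
        simp only [entries_apply]
        ring
  · refine algCone_subset_tangentCone_of_independent_three ciPoly_12_3 ciPoly_12_4 ciPoly_34_1 hx
      fun u v w h => ?_
    obtain ⟨a1, a2, a3, a4, a5, a6⟩ := forall_pairs.1 h
    simp [pderiv_X, -mul_eq_zero] at a1 a2 a3 a4 a5 a6
    have hw : w = 0 := by linear_combination a6
    have hv : v = 0 := by
      by_contra hv
      have hu : u = -v := by linear_combination a1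
      exact hs ⟨by simpa [hu, hv] using a4, by simpa [hv] using a5, by simpa [hu, hv, hw] using a2,
        by simpa [hv, hw] using a3⟩
    simp_all

theorem tangentCone_L29 {x : Pairs 4 → ℝ} (hx : x ∈ Vcor L29) :
    tangentCone (Vcor L29) x = algCone L29 x := by
  refine (tangentCone_subset_algCone hx).antisymm ?_
  have hpd := hx.1
  have hx' := hx.2
  simp only [L29, Set.mem_insert_iff, Set.mem_singleton_iff, forall_eq_or_imp, forall_eq,
    ciDet_23, ciDet_23_14] at hx'
  obtain ⟨h1, h2⟩ := hx'
  by_cases hs : x e12 = 0 ∧ x e13 = 0 ∧ x e24 = 0 ∧ x e34 = 0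
  · obtain ⟨s1, s2, s3, s4⟩ := hs
    obtain ⟨ρ, rfl⟩ : ∃ ρ, x = Pi.single e14 ρ := by
      refine ⟨x e14, ?_⟩
      rw [single_e14]
      refine entries_ext ?_ ?_ ?_ ?_ ?_ ?_ <;> simp only [entries_apply] <;> assumption
    intro t ht
    rw [mem_algCone_iff (coneIdeal_L29 ρ)] at ht
    simp only [Set.mem_insert_iff, Set.mem_singleton_iff, forall_eq_or_imp, forall_eq, map_add,
      map_sub, map_mul, eval_X, eval_C] at ht
    obtain ⟨t1, tq⟩ := ht
    have hρ : 1 - ρ ^ 2 ≠ 0 := by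
      have := sq_lt_one_of_posDef hpd e14
      rw [Pi.single_eq_same] at this
      exact (sub_pos.2 this).ne'
    have hcont : ContinuousAt (fun τ : ℝ => 1 - (ρ + τ * t e14) ^ 2) 0 := by fun_prop
    have hne : 1 - (ρ + 0 * t e14) ^ 2 ≠ 0 := by simpa using hρ
    have hev := hcont.eventually_ne hne
    -- For r23 = 0 the couple 23|14 reads r13 (r12 - r14 r24) + r34 (r24 - r14 r12) = 0. With r14 =
    -- ρ + τ t14, the entries r12 and r24 solve the linear system that makes the two brackets equal
    -- to τ (t12 - ρ t24) and τ (t24 - ρ t12), so the equation becomes τ² times the quadratic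
    -- relation on t.
    have d1 : HasDerivAt (fun τ => τ * ((t e12 - ρ * t e24 + (ρ + τ * t e14) * (t e24 - ρ * t e12)) /
        (1 - (ρ + τ * t e14) ^ 2))) (t e12) 0 := by
      refine hasDerivAt_mul_of_continuousAt (ContinuousAt.div (by fun_prop) hcont hne) ?_
      simp only [Pi.div_apply, zero_mul, add_zero]
      field_simp
      ring
    have d2 : HasDerivAt (fun τ => τ * ((t e24 - ρ * t e12 + (ρ + τ * t e14) * (t e12 - ρ * t e24)) /
        (1 - (ρ + τ * t e14) ^ 2))) (t e24) 0 := by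
      refine hasDerivAt_mul_of_continuousAt (ContinuousAt.div (by fun_prop) hcont hne) ?_
      simp only [Pi.div_apply, zero_mul, add_zero]
      field_simp
      ring
    refine mem_tangentCone_Vcor hx
      (y := fun τ => entries
        (τ * ((t e12 - ρ * t e24 + (ρ + τ * t e14) * (t e24 - ρ * t e12)) /
          (1 - (ρ + τ * t e14) ^ 2)))
        (τ * t e13) (ρ + τ * t e14) 0
        (τ * ((t e24 - ρ * t e12 + (ρ + τ * t e14) * (t e12 - ρ * t e24)) /
          (1 - (ρ + τ * t e14) ^ 2)))
        (τ * t e34))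
      (hasDerivAt_entries
        d1
        (hasDerivAt_mul_of_continuousAt (continuousAt_const) rfl)
        (hasDerivAt_const_add_mul _ _)
        (hasDerivAt_zero_of_eq t1)
        d2
        (hasDerivAt_mul_of_continuousAt (continuousAt_const) rfl))
      ?_ ?_
    · rw [single_e14]
      exact entries_ext (by simp) (by simp) (by simp) (by simp) (by simp) (by simp)
    · filter_upwards [hev] with τ hτ
      rintro c (rfl | rfl)
      · rw [ciDet_23]
        simp only [entries_apply]
      · rw [ciDet_23_14]
        simp only [entries_apply]
        field_simp
        linear_combination -τ ^ 2 * (1 - (ρ + τ * t e14) ^ 2) * tq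
  · refine algCone_subset_tangentCone_of_independent_two ciPoly_23 ciPoly_23_14 hx
      fun u v h => ?_
    obtain ⟨a1, a2, a3, a4, a5, a6⟩ := forall_pairs.1 h
    simp [pderiv_X, -mul_eq_zero] at a1 a2 a3 a4 a5 a6
    have hc := sq_lt_one_of_posDef hpd e14
    have hv : v = 0 := by
      by_contra hv
      have b1 : x e13 = x e14 * x e34 := by
        refine mul_left_cancel₀ hv ?_
        linear_combination -a1
      have b2 : x e12 = x e14 * x e24 := by
        refine mul_left_cancel₀ hv ?_
        linear_combination -a2
      have b5 : x e34 = x e14 * x e13 := by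
        refine mul_left_cancel₀ hv ?_
        linear_combination -a5
      have b6 : x e24 = x e14 * x e12 := by
        refine mul_left_cancel₀ hv ?_
        linear_combination -a6
      -- The four equations form two homogeneous 2 × 2 systems of determinant 1 - r14².
      have hne : 1 - x e14 ^ 2 ≠ 0 := (sub_pos.2 hc).ne'
      refine hs ⟨mul_left_cancel₀ hne ?_, mul_left_cancel₀ hne ?_, mul_left_cancel₀ hne ?_,
        mul_left_cancel₀ hne ?_⟩
      · linear_combination b2 + x e14 * b6
      · linear_combination b1 + x e14 * b5
      · linear_combination b6 + x e14 * b2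
      · linear_combination b5 + x e14 * b1
    simp_all

theorem tangentCone_L32 {x : Pairs 4 → ℝ} (hx : x ∈ Vcor L32) :
    tangentCone (Vcor L32) x = algCone L32 x := by
  refine (tangentCone_subset_algCone hx).antisymm ?_
  have hpd := hx.1
  have hx' := hx.2
  simp only [L32, Set.mem_insert_iff, Set.mem_singleton_iff, forall_eq_or_imp, forall_eq,
    ciDet_12_3, ciDet_12_4] at hx'
  obtain ⟨h1, h2⟩ := hx'
  by_cases hs : x e13 = 0 ∧ x e14 = 0 ∧ x e23 = 0 ∧ x e24 = 0
  · obtain ⟨s1, s2, s3, s4⟩ := hs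
    obtain ⟨ρ, rfl⟩ : ∃ ρ, x = Pi.single e34 ρ := by
      refine ⟨x e34, ?_⟩
      rw [single_e34]
      refine entries_ext ?_ ?_ ?_ ?_ ?_ ?_ <;> simp only [entries_apply] <;>
        first
        | assumption
        | simp_all
    intro t ht
    rw [mem_algCone_iff (coneIdeal_L32 ρ)] at ht
    simp only [Set.mem_insert_iff, Set.mem_singleton_iff, forall_eq_or_imp, forall_eq, map_sub,
      map_mul, eval_X] at ht
    obtain ⟨t1, tq⟩ := ht
    refine mem_tangentCone_Vcor hx
      (y := fun τ => entries (τ * (τ * (t e13 * t e23))) (τ * t e13) (τ * t e14) (τ * t e23) (τ * t e24)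
        (ρ + τ * t e34))
      (hasDerivAt_entries
        (hasDerivAt_mul_of_continuousAt (by fun_prop) (by simp [t1]))
        (hasDerivAt_mul_of_continuousAt (continuousAt_const) rfl)
        (hasDerivAt_mul_of_continuousAt (continuousAt_const) rfl)
        (hasDerivAt_mul_of_continuousAt (continuousAt_const) rfl)
        (hasDerivAt_mul_of_continuousAt (continuousAt_const) rfl)
        (hasDerivAt_const_add_mul _ _))
      ?_ ?_
    · rw [single_e34]
      exact entries_ext (by simp) (by simp) (by simp) (by simp) (by simp) (by simp)
    · filter_upwards with τ
      rintro c (rfl | rfl)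
      · rw [ciDet_12_3]
        simp only [entries_apply]
        ring
      · rw [ciDet_12_4]
        simp only [entries_apply]
        linear_combination τ ^ 2 * tq
  · refine algCone_subset_tangentCone_of_independent_two ciPoly_12_3 ciPoly_12_4 hx
      fun u v h => ?_
    obtain ⟨a1, a2, a3, a4, a5, a6⟩ := forall_pairs.1 h
    simp [pderiv_X, -mul_eq_zero] at a1 a2 a3 a4 a5 a6
    have hv : v = 0 := by
      by_contra hv
      have hu : u = -v := by linear_combination a1
      exact hs ⟨by simpa [hu, hv] using a4, by simpa [hv] using a5, by simpa [hu, hv] using a2,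
        by simpa [hv] using a3⟩
    simp_all

/-! ### Failure of smoothness at the identity -/

lemma not_isSmoothManifold_L14 : ¬ IsSmoothManifold (Vcor L14) := by
  -- The two directions are the factors of one monomial of q: each is a zero of q, their sum is not.
  -- The other seven relations use the same choice.
  refine not_isSmoothManifold (t := entries 1 0 0 0 0 0) (u := entries 0 0 0 0 1 0) ?_
    (fun _ => tangentCone_L14) ?_ ?_ ?_
  · exact zero_mem_Vcor (by simp [L14, ciDet_14, ciDet_14_23, ciDet_23_14])
  · rw [mem_algCone_iff coneIdeal_L14]
    simp
  · rw [mem_algCone_iff coneIdeal_L14]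
    simp
  · rw [mem_algCone_iff coneIdeal_L14]
    simp

lemma not_isSmoothManifold_L46 : ¬ IsSmoothManifold (Vcor L46) := by
  refine not_isSmoothManifold (t := entries 1 0 0 0 0 0) (u := entries 0 0 0 0 1 0) ?_
    (fun _ => tangentCone_L46) ?_ ?_ ?_
  · exact zero_mem_Vcor (by simp [L46, ciDet_14, ciDet_14_23, ciDet_23])
  · rw [mem_algCone_iff coneIdeal_L46]
    simp
  · rw [mem_algCone_iff coneIdeal_L46]
    simp
  · rw [mem_algCone_iff coneIdeal_L46]
    simp

lemma not_isSmoothManifold_L20 : ¬ IsSmoothManifold (Vcor L20) := by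
  refine not_isSmoothManifold (t := entries 1 0 0 0 0 0) (u := entries 0 0 0 0 1 0) ?_
    (fun _ => tangentCone_L20) ?_ ?_ ?_
  · exact zero_mem_Vcor (by simp [L20, ciDet_14_2, ciDet_14_3, ciDet_23_14])
  · rw [mem_algCone_iff coneIdeal_L20]
    simp
  · rw [mem_algCone_iff coneIdeal_L20]
    simp
  · rw [mem_algCone_iff coneIdeal_L20]
    simp

lemma not_isSmoothManifold_L51 : ¬ IsSmoothManifold (Vcor L51) := by
  refine not_isSmoothManifold (t := entries 1 0 0 0 0 0) (u := entries 0 0 0 0 1 0) ?_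
    (fun _ => tangentCone_L51) ?_ ?_ ?_
  · exact zero_mem_Vcor (by simp [L51, ciDet_14_2, ciDet_14_3, ciDet_23])
  · rw [mem_algCone_iff coneIdeal_L51]
    simp
  · rw [mem_algCone_iff coneIdeal_L51]
    simp
  · rw [mem_algCone_iff coneIdeal_L51]
    simp

lemma not_isSmoothManifold_L30 : ¬ IsSmoothManifold (Vcor L30) := by
  refine not_isSmoothManifold (t := entries 1 0 0 0 0 0) (u := entries 0 1 0 0 0 0) ?_
    (fun _ => tangentCone_L30) ?_ ?_ ?_
  · exact zero_mem_Vcor (by simp [L30, ciDet_14_2, ciDet_23, ciDet_23_14])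
  · rw [mem_algCone_iff coneIdeal_L30]
    simp
  · rw [mem_algCone_iff coneIdeal_L30]
    simp
  · rw [mem_algCone_iff coneIdeal_L30]
    simp

lemma not_isSmoothManifold_L36 : ¬ IsSmoothManifold (Vcor L36) := by
  refine not_isSmoothManifold (t := entries 0 1 0 0 0 0) (u := entries 0 0 0 1 0 0) ?_
    (fun _ => tangentCone_L36) ?_ ?_ ?_
  · exact zero_mem_Vcor (by simp [L36, ciDet_12_3, ciDet_12_4, ciDet_34_1])
  · rw [mem_algCone_iff coneIdeal_L36]
    simp
  · rw [mem_algCone_iff coneIdeal_L36]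
    simp
  · rw [mem_algCone_iff coneIdeal_L36]
    simp

lemma not_isSmoothManifold_L29 : ¬ IsSmoothManifold (Vcor L29) := by
  -- The identity is the point ρ = 0 of the singular line.
  have hc := coneIdeal_L29 0
  rw [Pi.single_zero] at hc
  refine not_isSmoothManifold (t := entries 1 0 0 0 0 0) (u := entries 0 1 0 0 0 0) ?_
    (fun _ => tangentCone_L29) ?_ ?_ ?_
  · exact zero_mem_Vcor (by simp [L29, ciDet_23, ciDet_23_14])
  · rw [mem_algCone_iff hc]
    simp
  · rw [mem_algCone_iff hc]
    simp
  · rw [mem_algCone_iff hc]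
    simp

lemma not_isSmoothManifold_L32 : ¬ IsSmoothManifold (Vcor L32) := by
  have hc := coneIdeal_L32 0
  rw [Pi.single_zero] at hc
  refine not_isSmoothManifold (t := entries 0 1 0 0 0 0) (u := entries 0 0 0 1 0 0) ?_
    (fun _ => tangentCone_L32) ?_ ?_ ?_
  · exact zero_mem_Vcor (by simp [L32, ciDet_12_3, ciDet_12_4])
  · rw [mem_algCone_iff hc]
    simp
  · rw [mem_algCone_iff hc]
    simp
  · rw [mem_algCone_iff hc]
    simp

end GaussianCI

theorem mainTheorem3 :
    -- the tangent cone is the algebraic cone at all singularities, and the models are non-smooth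
    (∀ L ∈ ({GaussianCI.L14, GaussianCI.L20, GaussianCI.L29, GaussianCI.L30, GaussianCI.L32,
        GaussianCI.L36, GaussianCI.L46, GaussianCI.L51} : Set (Set (GaussianCI.CICouple 4))),
      (∀ R₀ ∈ GaussianCI.singularities L,
        GaussianCI.tangentCone (GaussianCI.Vcor L) R₀ = GaussianCI.algCone L R₀) ∧
      ¬ GaussianCI.IsSmoothManifold (GaussianCI.Vcor L)) ∧
    -- explicit generators; the identity matrix has the coordinate vector `0`
    (GaussianCI.coneIdeal GaussianCI.L14 0 = Ideal.span {X GaussianCI.e14, X GaussianCI.e23,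
      X GaussianCI.e12 * X GaussianCI.e24 + X GaussianCI.e13 * X GaussianCI.e34}) ∧
    (GaussianCI.coneIdeal GaussianCI.L46 0 = Ideal.span {X GaussianCI.e14, X GaussianCI.e23,
      X GaussianCI.e12 * X GaussianCI.e24 + X GaussianCI.e13 * X GaussianCI.e34}) ∧
    (GaussianCI.coneIdeal GaussianCI.L20 0 = Ideal.span {X GaussianCI.e14, X GaussianCI.e23,
      X GaussianCI.e12 * X GaussianCI.e24 - X GaussianCI.e13 * X GaussianCI.e34}) ∧
    (GaussianCI.coneIdeal GaussianCI.L51 0 = Ideal.span {X GaussianCI.e14, X GaussianCI.e23,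
      X GaussianCI.e12 * X GaussianCI.e24 - X GaussianCI.e13 * X GaussianCI.e34}) ∧
    (GaussianCI.coneIdeal GaussianCI.L30 0 = Ideal.span {X GaussianCI.e14, X GaussianCI.e23,
      X GaussianCI.e12 * X GaussianCI.e13 + X GaussianCI.e24 * X GaussianCI.e34}) ∧
    (GaussianCI.coneIdeal GaussianCI.L36 0 = Ideal.span {X GaussianCI.e12, X GaussianCI.e34,
      X GaussianCI.e13 * X GaussianCI.e23 - X GaussianCI.e14 * X GaussianCI.e24}) ∧
    (∀ ρ : ℝ, |ρ| < 1 →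
      GaussianCI.coneIdeal GaussianCI.L29 (Pi.single GaussianCI.e14 ρ) =
        Ideal.span {X GaussianCI.e23,
          X GaussianCI.e13 * (X GaussianCI.e12 - C ρ * X GaussianCI.e24) +
            X GaussianCI.e34 * (X GaussianCI.e24 - C ρ * X GaussianCI.e12)}) ∧
    (∀ ρ : ℝ, |ρ| < 1 →
      GaussianCI.coneIdeal GaussianCI.L32 (Pi.single GaussianCI.e34 ρ) =
        Ideal.span {X GaussianCI.e12,
          X GaussianCI.e13 * X GaussianCI.e23 - X GaussianCI.e14 * X GaussianCI.e24}) := by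
  refine ⟨?_, GaussianCI.coneIdeal_L14, GaussianCI.coneIdeal_L46, GaussianCI.coneIdeal_L20,
    GaussianCI.coneIdeal_L51, GaussianCI.coneIdeal_L30, GaussianCI.coneIdeal_L36,
    fun ρ _ => GaussianCI.coneIdeal_L29 ρ, fun ρ _ => GaussianCI.coneIdeal_L32 ρ⟩
  rintro L (rfl | rfl | rfl | rfl | rfl | rfl | rfl | rfl)
  · exact ⟨fun R₀ h => GaussianCI.tangentCone_L14 h.1, GaussianCI.not_isSmoothManifold_L14⟩
  · exact ⟨fun R₀ h => GaussianCI.tangentCone_L20 h.1, GaussianCI.not_isSmoothManifold_L20⟩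
  · exact ⟨fun R₀ h => GaussianCI.tangentCone_L29 h.1, GaussianCI.not_isSmoothManifold_L29⟩
  · exact ⟨fun R₀ h => GaussianCI.tangentCone_L30 h.1, GaussianCI.not_isSmoothManifold_L30⟩
  · exact ⟨fun R₀ h => GaussianCI.tangentCone_L32 h.1, GaussianCI.not_isSmoothManifold_L32⟩
  · exact ⟨fun R₀ h => GaussianCI.tangentCone_L36 h.1, GaussianCI.not_isSmoothManifold_L36⟩
  · exact ⟨fun R₀ h => GaussianCI.tangentCone_L46 h.1, GaussianCI.not_isSmoothManifold_L46⟩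
  · exact ⟨fun R₀ h => GaussianCI.tangentCone_L51 h.1, GaussianCI.not_isSmoothManifold_L51⟩
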